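/- Let $p$ be a prime. For a finite $p$-group $G$ put $\mathcal K(G)=\{x\in G: |x|<\exp(G)\}$, where $|x|$ is the order of $x$; $G$ is of \emph{GK type} if $\mathcal K(G)$ is a maximal subgroup of $G$, and then $\mathcal K(G)$ is its \emph{GK kernel}. Put $\mathcal K^0(G)=G$ and $\mathcal K^{i+1}(G)=\mathcal K(\mathcal K^i(G))$. If $\mathcal K^i(G)$ is of GK type for all $i<l$ while $\mathcal K^l(G)\cong R$ is not, then $G$ has \emph{GK level} $l$ and \emph{GK root} $R$. For a finite $p$-group $R$ not of GK type, the \emph{GK tree} $\mathcal T(R)$ is the directed graph whose vertices are $R$ and the finite $p$-groups of GK type with GK root $R$ (up to isomorphism), with precisely one edge $G\to\mathcal K(G)$ emanating from every vertex $G$ of GK type. A \emph{stem} is an infinite directed path $\cdots\to H_2\to H_1\to H_0=R$. For a vertex $H$ on a stem, the \emph{bush} rooted in $H$ consists of $H$ and of all vertices $G$ such that $H$ is the first vertex lying on a stem on the directed path from $G$ to $R$. If there is precisely one stem $(H_s)_{s\ge 0}$, the tree is \emph{periodic from level $l$ on} if for all $s\ge l$ the bushes rooted in $H_s$ and in $H_{s+1}$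 are isomorphic as directed graphs. The \emph{cyclic deficiency} of $G$ is $\delta(G)=\log_p(|G|/\exp(G))$. For $l\ge 1$ let $G_l=\langle y\rangle\rtimes\langle g\rangle\cong C_{p^{l+1}}\rtimes C_p$, where $y^g=g^{-1}yg=y^{1+p^l}$. The group $C_p^2$ is not of GK type, and its GK tree is as follows. (a) $\mathcal T(C_p^2)$ has a unique stem $\cdots\to H_1\to H_0$; on level $l\ge 0$ it is occupied by $H_l=C_p\times C_{p^{l+1}}$. A vertex lies on the stem if and only if it is an abelian group. (b) Let $l\ge 1$ and $(p,l)\neq(2,1)$. Then $G_l$ is non-abelian of order $p^{l+2}$ and cyclic deficiency $1$, is of GK type with $\mathcal K(G_l)\cong C_p\times C_{p^l}$, and has GK level $l$ and GK root $C_p^2$. The bush rooted in $H_{l-1}$ consists precisely of $H_{l-1}$ and $G_l$, joined by the edge $G_l\to H_{l-1}$. (c) If $p=2$, then the bush rooted in $H_0$ consists of $H_0$ only, and $H_1=C_2\times C_4$ is the only vertex of level $1$. (d) Consequently the vertices of $\mathcal T(C_p^2)$ are precisely the groups $H_l$ ($l\ge 0$) and $G_l$ ($l\ge 1$, $(p,l)\ne(2,1)$),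 and the edges are precisely $H_l\to H_{l-1}$ ($l\ge 1$) and $G_l\to H_{l-1}$ ($l\ge 1$, $(p,l)\neq(2,1)$). All these groups have generator rank $2$. (e) $\mathcal T(C_p^2)$ is periodic from level $0$ on if $p$ is odd, and $\mathcal T(C_2^2)$ is periodic from level $1$ on. For $p$ odd, the subgraphs of $\mathcal T(C_2^2)$ and $\mathcal T(C_p^2)$ induced on the vertices of level at least $2$ are isomorphic by a level-preserving isomorphism. (f) Let $l\ge1$. A non-abelian group of order $p^{l+2}$ and cyclic deficiency $1$ is of GK type if and only if $(p,l)\neq(2,1)$ and it is isomorphic to $G_l$. If $p$ is odd, every such group is isomorphic to $G_l$, and hence is of GK type. For $p=2$, the dihedral and the generalised quaternion group of order $2^{l+2}$, for $l\ge 1$, and the semidihedral group of order $2^{l+2}$, for $l\ge 2$, are not of GK type. -/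

import Mathlib

namespace GK

/-! ### Groups of GK type -/

/-- The set `𝒦(G)` of all elements of non-maximal order. For a finite `p`-group the exponent is the
maximal element order. -/
def gkSet (G : Type*) [Group G] : Set G := {g | orderOf g < Monoid.exponent G}

/-- `G` is a finite `p`-group of Gorenstein-Kulkarni type: the set `𝒦(G)` is a maximal subgroup. -/
def IsGKType (p : ℕ) (G : Type*) [Group G] : Prop :=
  Finite G ∧ IsPGroup p G ∧ ∃ M : Subgroup G, IsCoatom M ∧ (M : Set G) = gkSet G

/-- The GK kernel, as a subgroup. If `G` is of GK type, then `gkSet G` is a subgroup, and the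
closure adds nothing; for other groups this is a value that is never used below. -/
def gkKernel (G : Type*) [Group G] : Subgroup G := Subgroup.closure (gkSet G)

/-- The GK series `𝒦⁰(G) = G`, `𝒦ⁱ⁺¹(G) = 𝒦(𝒦ⁱ(G))`, as subgroups of `G`. -/
def gkSeries (G : Type*) [Group G] : ℕ → Subgroup G
  | 0 => ⊤
  | i + 1 => (gkKernel (gkSeries G i)).map (gkSeries G i).subtype

/-- `G` has GK level `l` and GK root (isomorphic to) `R`: the groups `𝒦ⁱ(G)`, `i < l`, are of
GK type, while `𝒦ˡ(G) ≅ R` is not. For `l = 0` this says that `G ≅ R` is not of GK type. -/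
def HasGKRoot (p : ℕ) (G : Type*) [Group G] (R : Type*) [Group R] (l : ℕ) : Prop :=
  (∀ i < l, IsGKType p (gkSeries G i)) ∧ ¬ IsGKType p (gkSeries G l) ∧
    Nonempty (gkSeries G l ≃* R)

/-- The cyclic deficiency `δ(G) = log_p |G| - log_p (exp G)` of a finite `p`-group. -/
noncomputable def cyclicDeficiency (p : ℕ) (G : Type*) [Group G] : ℕ :=
  Nat.log p (Nat.card G) - Nat.log p (Monoid.exponent G)

/-! ### Isomorphism types of finite groups -/

/-- Isomorphism of finite groups. -/
def isoSetoid : Setoid FiniteGrp.{0} where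
  r G H := Nonempty (G ≃* H)
  iseqv := ⟨fun _ => ⟨MulEquiv.refl _⟩, fun ⟨e⟩ => ⟨e.symm⟩, fun ⟨e⟩ ⟨f⟩ => ⟨e.trans f⟩⟩

/-- Isomorphism types of finite groups. -/
def IsoType : Type 1 := Quotient isoSetoid

/-- The isomorphism type of a finite group. -/
def isoType (G : Type) [Group G] [Finite G] : IsoType :=
  Quotient.mk isoSetoid (FiniteGrp.of G)

theorem isoType_eq_iff (G H : Type) [Group G] [Finite G] [Group H] [Finite H] :
    isoType G = isoType H ↔ Nonempty (G ≃* H) :=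
  Quotient.eq (r := isoSetoid)

/-! ### GK trees -/

/-- The vertices of the GK tree `𝒯(R)`: the root `R` and the isomorphism types of the finite
`p`-groups of GK type having `R` as their GK root. -/
def GKVertex (p : ℕ) (R : Type) [Group R] [Finite R] : Type 1 :=
  {v : IsoType // v = isoType R ∨
    ∃ G : FiniteGrp.{0}, v = isoType G ∧ IsGKType p G ∧ ∃ l, HasGKRoot p G R l}

/-- The GK tree `𝒯(R)`: one edge `G → 𝒦(G)` emanates from every vertex `G` of GK type. -/
def gkTree (p : ℕ) (R : Type) [Group R] [Finite R] : Digraph (GKVertex p R) where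
  Adj v w := ∃ G : FiniteGrp.{0}, v.1 = isoType G ∧ IsGKType p G ∧ w.1 = isoType (gkKernel G)

/-- The root of the GK tree. -/
def gkTreeRoot (p : ℕ) (R : Type) [Group R] [Finite R] : GKVertex p R := ⟨isoType R, Or.inl rfl⟩

/-- The vertex `v` of `𝒯(R)` has GK level `l`. -/
def HasLevel (p : ℕ) (R : Type) [Group R] [Finite R] (v : GKVertex p R) (l : ℕ) : Prop :=
  ∃ G : FiniteGrp.{0}, v.1 = isoType G ∧ HasGKRoot p G R l

section Digraph

variable {V : Type*} (T : Digraph V) (r : V)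

/-- `⋯ → H 2 → H 1 → H 0 = r` is an infinite directed path ending in the root `r`. -/
def IsStem (H : ℕ → V) : Prop := H 0 = r ∧ ∀ n, T.Adj (H (n + 1)) (H n)

/-- The vertex `v` lies on some stem. -/
def OnStem (v : V) : Prop := ∃ H : ℕ → V, IsStem T r H ∧ ∃ n, H n = v

/-- Walking from `v` towards the root, the first vertex lying on a stem is `h`, and it is
reached after `t` steps; thus `v` has depth `t` and branches off the stem at `h`. -/
def BranchesAt (v h : V) (t : ℕ) : Prop :=
  ∃ f : ℕ → V, f 0 = v ∧ f t = h ∧ (∀ i < t, T.Adj (f i) (f (i + 1))) ∧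
    (∀ i < t, ¬ OnStem T r (f i)) ∧ OnStem T r h

/-- The vertices of the bush rooted at a vertex `h` lying on a stem: the vertex `h`, together with
the vertices branching off the stem at `h`. Its edges are the edges of `T` between them. -/
def bush (h : V) : Set V := {v | v = h ∨ ∃ t, BranchesAt T r v h t}

/-- `T` has precisely one stem `H`, and from level `l` on it is `k`-periodic: for all `s ≥ l` the
bushes rooted at `H s` and at `H (s + k)` are isomorphic directed graphs. -/
def IsPeriodicFrom (k l : ℕ) : Prop :=
  (∃! H : ℕ → V, IsStem T r H) ∧ ∀ H : ℕ → V, IsStem T r H → ∀ s, l ≤ s →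
    Nonempty (Subrel T.Adj (· ∈ bush T r (H s)) ≃r Subrel T.Adj (· ∈ bush T r (H (s + k))))

end Digraph

/-! ### The groups -/

/-- The cyclic group of order `n` (for `n ≠ 0`), written multiplicatively. -/
abbrev C (n : ℕ) : Type := Multiplicative (ZMod n)

/-- The action of `C m` on `C n` whose generator acts by `y ↦ y ^ u⁻¹`. -/
noncomputable def powAction (n m : ℕ) (u : (ZMod n)ˣ) (hu : u ^ m = 1) : C m →* MulAut (C n) :=
  ((MulAutMultiplicative (ZMod n)).symm.toMonoidHom.comp AddAut.mulLeft).comp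
    (AddMonoidHom.toMultiplicativeLeft
      (ZMod.lift m ⟨zmultiplesHom (Additive (ZMod n)ˣ) (Additive.ofMul u⁻¹), by
        simpa using congrArg (fun x => Additive.ofMul x⁻¹) hu⟩))

/-- The split extension `⟨y⟩ ⋊ ⟨g⟩` of `C n` by `C m`, where `y ^ g = g⁻¹ y g = y ^ u`. -/
abbrev CyclicSplit (n m : ℕ) (u : (ZMod n)ˣ) (hu : u ^ m = 1) : Type :=
  SemidirectProduct (C n) (C m) (powAction n m u hu)

/-- The defining relation `g⁻¹ y g = y ^ u` of `CyclicSplit`. -/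
theorem CyclicSplit.conj (n m : ℕ) (u : (ZMod n)ˣ) (hu : u ^ m = 1) (y : ZMod n) :
    ((SemidirectProduct.inr (Multiplicative.ofAdd 1))⁻¹ *
      SemidirectProduct.inl (Multiplicative.ofAdd y) *
      SemidirectProduct.inr (Multiplicative.ofAdd 1) : CyclicSplit n m u hu) =
    SemidirectProduct.inl (Multiplicative.ofAdd ((u : ZMod n) * y)) := by
  rw [← map_inv SemidirectProduct.inr, ← SemidirectProduct.inl_aut_inv]
  congr 1
  rw [MulAut.inv_apply, MulEquiv.symm_apply_eq]
  have h : ((AddMonoidHom.toMultiplicativeLeft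
      (ZMod.lift m ⟨zmultiplesHom (Additive (ZMod n)ˣ) (Additive.ofMul u⁻¹), by
        simpa using congrArg (fun x => Additive.ofMul x⁻¹) hu⟩))
        (Multiplicative.ofAdd (1 : ZMod m)) : (ZMod n)ˣ) = u⁻¹ := by
    have := ZMod.lift_coe m ⟨zmultiplesHom (Additive (ZMod n)ˣ) (Additive.ofMul u⁻¹), by
        simpa using congrArg (fun x => Additive.ofMul x⁻¹) hu⟩ 1
    simp at this
    simp [this]
  simp only [powAction, MonoidHom.comp_apply, h]
  apply Multiplicative.toAdd.injective
  change y = ((u⁻¹ : (ZMod n)ˣ) : ZMod n) * ((u : ZMod n) * y)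
  rw [← mul_assoc, Units.inv_mul, one_mul]

instance (n m : ℕ) [NeZero n] [NeZero m] (u : (ZMod n)ˣ) (hu : u ^ m = 1) :
    Finite (CyclicSplit n m u hu) :=
  Finite.of_equiv _ (SemidirectProduct.equivProd (φ := powAction n m u hu)).symm

theorem one_add_pow_pow_aux {R : Type*} [CommRing R] (p l : ℕ) (hl : 1 ≤ l)
    (h0 : (p : R) ^ (l + 1) = 0) : (1 + (p : R) ^ l) ^ p = 1 := by
  have h2 : (p : R) ^ l * (p : R) ^ l = 0 := by
    rw [← pow_add, show l + l = (l + 1) + (l - 1) by omega, pow_add, h0, zero_mul]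
  have key : ∀ n : ℕ, (1 + (p : R) ^ l) ^ n = 1 + n * (p : R) ^ l := by
    intro n
    induction n with
    | zero => simp
    | succ n ih =>
      rw [pow_succ, ih]
      push_cast
      linear_combination (n : R) * h2
  rw [key, ← pow_succ', h0, add_zero]

theorem neg_one_add_pow_sq_aux {R : Type*} [CommRing R] (l : ℕ) (hl : 1 ≤ l)
    (h0 : (2 : R) ^ (l + 1) = 0) : (-1 + (2 : R) ^ l) ^ 2 = 1 := by
  have h2 : (2 : R) ^ l * (2 : R) ^ l = 0 := by
    rw [← pow_add, show l + l = (l + 1) + (l - 1) by omega, pow_add, h0, zero_mul]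
  rw [pow_succ] at h0
  linear_combination h2 - h0

theorem bushUnit_pow (p l : ℕ) (hl : 1 ≤ l) : (1 + (p : ZMod (p ^ (l + 1))) ^ l) ^ p = 1 :=
  one_add_pow_pow_aux p l hl (by exact_mod_cast ZMod.natCast_self (p ^ (l + 1)))

theorem sdUnit_pow (l : ℕ) (hl : 1 ≤ l) : (-1 + (2 : ZMod (2 ^ (l + 1))) ^ l) ^ 2 = 1 :=
  neg_one_add_pow_sq_aux l hl (by exact_mod_cast ZMod.natCast_self (2 ^ (l + 1)))

/-- The group `C_p × C_{p^{l+1}}`. -/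
abbrev StemGroup (p l : ℕ) : Type := C p × C (p ^ (l + 1))

/-- For `l ≥ 1`, the group `G_l = ⟨y⟩ ⋊ ⟨g⟩ ≅ C_{p^{l+1}} ⋊ C_p` with `y ^ g = y ^ (1 + p ^ l)`. -/
abbrev BushGroup (p l : ℕ) [Fact p.Prime] (hl : 1 ≤ l) : Type :=
  CyclicSplit (p ^ (l + 1)) p
    (Units.ofPowEqOne _ p (bushUnit_pow p l hl) (Fact.out : p.Prime).ne_zero)
    (Units.pow_ofPowEqOne _ _)

/-- For `l ≥ 2`, the semidihedral group `SD_{2^{l+2}} = ⟨y⟩ ⋊ ⟨g⟩ ≅ C_{2^{l+1}} ⋊ C_2` with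
`y ^ g = y ^ (-1 + 2 ^ l)`. -/
abbrev SemidihedralGroup (l : ℕ) (hl : 2 ≤ l) : Type :=
  CyclicSplit (2 ^ (l + 1)) 2
    (Units.ofPowEqOne _ 2 (sdUnit_pow l (by omega)) two_ne_zero)
    (Units.pow_ofPowEqOne _ _)

end GK

open GK

/-!
Passing from a group `G` of GK type to `𝒦(G)` divides both the order and the exponent by `p`
(`IsGKType.card_eq`, `IsGKType.exponent_eq`). A group on level `l` with root `C_p × C_p` therefore
has order `p ^ (l + 2)` and exponent `p ^ (l + 1)`, so it contains a cyclic normal subgroup `⟨y⟩` of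
index `p`, on which an element `x` outside acts by `y ↦ y ^ u`.

The residues `u` that matter are the one-units, `u ≡ 1` modulo `p`, and modulo `4` if `p = 2`. For
odd `p` every action is of this kind. For `p = 2` it is forced by GK type: taking `x` in the GK
kernel, the element `x` has non-maximal and `x * y` maximal order, which excludes `u ≡ 3` modulo `4`
(`exists_isOneUnit_of_isGKType`). The norm `1 + u + ⋯ + u ^ (p - 1)` of a one-unit is `p` times a
unit modulo every power of `p` (`IsOneUnit.geom_sum`). Hence `x` can be corrected by a power of `y`
so that `x ^ p = 1` (`exists_isSplitPair_of_isOneUnit`), and `u ≡ 1` modulo `p ^ l`. Replacing `x`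
by a power leaves only `u = 1` and `u = 1 + p ^ l`, that is, the stem group and the bush group
(`nonempty_mulEquiv_of_card_of_exponent`).

Conversely, in such an extension with `l ≥ 1` the map `g ↦ g ^ p ^ l` is a homomorphism whose image
has order `p` and whose kernel is the set of elements of non-maximal order. So the group is of GK
type, and its GK kernel is `⟨y ^ p⟩ × ⟨x⟩`, the stem group one level below
(`IsSplitPair.isGKType`).

The tree is thus known: each stem group on a positive level and each bush group is joined to the
stem group one level below. The bijection `nodeEquiv` transports the questions about stems, bushes
and periodicity to the explicit graph on `Node p`. The dihedral, semidihedral and quaternion groups are not of GK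
type, since elements of non-maximal order generate them, except for the quaternion group of order
`8`, where the elements of non-maximal order form a subgroup of order `2`.
-/

namespace GK

/-! ### Groups of GK type -/

section General

variable {p : ℕ} {G H R S : Type*} [Group G] [Group H] [Group R] [Group S]

theorem image_gkSet (e : G ≃* H) : e '' gkSet G = gkSet H := by
  ext h
  simp only [gkSet, Set.mem_image, Set.mem_ofPred_eq, Monoid.exponent_eq_of_mulEquiv e]
  constructor
  · rintro ⟨g, hg, rfl⟩
    rwa [MulEquiv.orderOf_eq]
  · intro hh
    exact ⟨e.symm h, by rwa [MulEquiv.orderOf_eq], e.apply_symm_apply h⟩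

theorem IsGKType.congr (e : G ≃* H) (h : IsGKType p G) : IsGKType p H := by
  obtain ⟨hf, hp, M, hM, hMK⟩ := h
  refine ⟨Finite.of_equiv G e.toEquiv, hp.of_equiv e, M.map (e : G →* H), ?_, ?_⟩
  · exact (e.mapSubgroup.isCoatom_iff M).2 hM
  · rw [Subgroup.coe_map, hMK]
    exact image_gkSet e

theorem map_gkKernel (e : G ≃* H) : (gkKernel G).map (e : G →* H) = gkKernel H := by
  rw [gkKernel, gkKernel, MonoidHom.map_closure]
  congr 1
  exact image_gkSet e

/-- An isomorphism of groups restricts to the GK kernels. -/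
noncomputable def gkKernelCongr (e : G ≃* H) : gkKernel G ≃* gkKernel H :=
  (e.subgroupMap (gkKernel G)).trans (MulEquiv.subgroupCongr (map_gkKernel e))

/-- The terms of the GK series are iterated GK kernels, up to isomorphism. -/
noncomputable def gkSeriesSucc (i : ℕ) : gkSeries G (i + 1) ≃* gkKernel (gkSeries G i) :=
  (Subgroup.equivMapOfInjective _ _ (Subgroup.subtype_injective _)).symm

theorem nonempty_gkSeries_congr (e : G ≃* H) (i : ℕ) :
    Nonempty (gkSeries G i ≃* gkSeries H i) := by
  induction i with
  | zero => exact ⟨Subgroup.topEquiv.trans (e.trans Subgroup.topEquiv.symm)⟩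
  | succ i ih =>
    obtain ⟨f⟩ := ih
    exact ⟨(gkSeriesSucc i).trans ((gkKernelCongr f).trans (gkSeriesSucc i).symm)⟩

/-- `𝒦ⁱ⁺¹(G)` is `𝒦ⁱ(𝒦(G))`. -/
theorem nonempty_gkSeries_succ (i : ℕ) :
    Nonempty (gkSeries G (i + 1) ≃* gkSeries (gkKernel G) i) := by
  induction i with
  | zero =>
    exact ⟨(gkSeriesSucc 0).trans ((gkKernelCongr Subgroup.topEquiv).trans
      Subgroup.topEquiv.symm)⟩
  | succ i ih =>
    obtain ⟨f⟩ := ih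
    exact ⟨(gkSeriesSucc (i + 1)).trans ((gkKernelCongr f).trans (gkSeriesSucc i).symm)⟩

theorem HasGKRoot.congr (e : G ≃* H) (f : R ≃* S) {l : ℕ} (h : HasGKRoot p G R l) :
    HasGKRoot p H S l := by
  obtain ⟨h1, h2, ⟨g⟩⟩ := h
  have E := nonempty_gkSeries_congr e
  exact ⟨fun i hi => (h1 i hi).congr (E i).some, fun h => h2 (h.congr (E l).some.symm),
    ⟨(E l).some.symm.trans (g.trans f)⟩⟩

theorem hasGKRoot_zero_iff :
    HasGKRoot p G R 0 ↔ ¬ IsGKType p G ∧ Nonempty (G ≃* R) := by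
  have e : gkSeries G 0 ≃* G := Subgroup.topEquiv
  refine ⟨fun ⟨_, h, ⟨f⟩⟩ => ⟨fun h' => h (h'.congr e.symm), ⟨e.symm.trans f⟩⟩,
    fun ⟨h, ⟨f⟩⟩ => ⟨fun i hi => absurd hi (by omega), fun h' => h (h'.congr e), ⟨e.trans f⟩⟩⟩

theorem hasGKRoot_succ_iff {l : ℕ} :
    HasGKRoot p G R (l + 1) ↔ IsGKType p G ∧ HasGKRoot p (gkKernel G) R l := by
  have E := nonempty_gkSeries_succ (G := G)
  have e : gkSeries G 0 ≃* G := Subgroup.topEquiv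
  constructor
  · rintro ⟨h1, h2, ⟨f⟩⟩
    exact ⟨(h1 0 (by omega)).congr e, fun i hi => (h1 (i + 1) (by omega)).congr (E i).some,
      fun h => h2 (h.congr (E l).some.symm), ⟨(E l).some.symm.trans f⟩⟩
  · rintro ⟨h0, h1, h2, ⟨f⟩⟩
    refine ⟨fun i hi => ?_, fun h => h2 (h.congr (E l).some), ⟨(E l).some.trans f⟩⟩
    cases i with
    | zero => exact h0.congr e.symm
    | succ i => exact (h1 i (by omega)).congr (E i).some.symm

theorem HasGKRoot.level_unique {l m : ℕ} (h : HasGKRoot p G R l) (h' : HasGKRoot p G S m) :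
    l = m := by
  rcases lt_trichotomy l m with hlt | heq | hgt
  · exact absurd (h'.1 l hlt) h.2.1
  · exact heq
  · exact absurd (h.1 m hgt) h'.2.1

theorem index_eq_of_isCoatom [Fact p.Prime] [Finite G] (hG : IsPGroup p G) {M : Subgroup G}
    (hM : IsCoatom M) : M.index = p := by
  obtain ⟨n, hn⟩ := hG.index M
  obtain ⟨m, hm⟩ := IsPGroup.iff_card.1 (hG.to_subgroup M)
  have hc := M.card_mul_index
  have hp := (Fact.out : p.Prime)
  rcases n with _ | n
  · rw [pow_zero, Subgroup.index_eq_one] at hn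
    exact absurd hn hM.1
  -- a subgroup of a `p`-group lies with index `p` in a larger one, here the whole group
  obtain ⟨K, hK, hMK⟩ := Sylow.exists_subgroup_card_pow_succ (G := G) (p := p) (n := m)
    (by rw [← hc, hm, hn, ← pow_add]; exact pow_dvd_pow _ (by omega)) hm
  have hne : M ≠ K := by
    rintro rfl
    rw [hm] at hK
    exact absurd (Nat.pow_right_injective hp.two_le hK) (by omega)
  have htop := hM.2 K (lt_of_le_of_ne hMK hne)
  subst htop
  rw [Subgroup.card_top, ← hc, hm, pow_succ] at hK
  exact Nat.eq_of_mul_eq_mul_left (pow_pos hp.pos m) hK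

theorem isCoatom_of_index_eq [Fact p.Prime] {M : Subgroup G} (hM : M.index = p) :
    IsCoatom M := by
  have hp := (Fact.out : p.Prime)
  refine ⟨fun h => hp.one_lt.ne' (by rw [← hM, h, Subgroup.index_top]), fun K hK => ?_⟩
  have h := Subgroup.relIndex_mul_index hK.le
  rw [hM] at h
  rcases hp.eq_one_or_self_of_dvd K.index ⟨_, by rw [mul_comm]; exact h.symm⟩ with h1 | h1
  · exact Subgroup.index_eq_one.1 h1
  · rw [h1] at h
    exact absurd (Subgroup.relIndex_eq_one.1
      (Nat.eq_of_mul_eq_mul_right hp.pos (by rw [h, one_mul]))) hK.not_ge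

theorem normal_of_isCoatom [Fact p.Prime] [Finite G] (hG : IsPGroup p G) {M : Subgroup G}
    (hM : IsCoatom M) : M.Normal := by
  have := hG.isNilpotent
  exact Subgroup.NormalizerCondition.normal_of_coatom M Group.normalizerCondition_of_isNilpotent hM

theorem IsGKType.coe_gkKernel (h : IsGKType p G) : (gkKernel G : Set G) = gkSet G := by
  obtain ⟨-, -, M, -, hM⟩ := h
  rw [gkKernel, ← hM, Subgroup.closure_eq]

theorem IsGKType.mem_gkKernel (h : IsGKType p G) {g : G} :
    g ∈ gkKernel G ↔ orderOf g < Monoid.exponent G := by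
  rw [← SetLike.mem_coe, h.coe_gkKernel]
  rfl

theorem IsGKType.isCoatom (h : IsGKType p G) : IsCoatom (gkKernel G) := by
  have h' := h
  obtain ⟨-, -, M, hM, hMK⟩ := h'
  rwa [← SetLike.coe_injective (hMK.trans h.coe_gkKernel.symm)]

theorem IsGKType.card_eq [Fact p.Prime] (h : IsGKType p G) :
    Nat.card G = p * Nat.card (gkKernel G) := by
  have := h.1
  rw [← index_eq_of_isCoatom h.2.1 h.isCoatom, mul_comm, Subgroup.card_mul_index]

theorem orderOf_dvd_of_lt_pow_succ [Fact p.Prime] {g : G} {e : ℕ} (h : orderOf g ∣ p ^ (e + 1))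
    (hlt : orderOf g < p ^ (e + 1)) : orderOf g ∣ p ^ e := by
  obtain ⟨k, hk, hkk⟩ := (Nat.dvd_prime_pow Fact.out).1 h
  rw [hkk] at hlt ⊢
  exact pow_dvd_pow _
    (Nat.lt_succ_iff.1 ((Nat.pow_lt_pow_iff_right (Fact.out : p.Prime).one_lt).1 hlt))

theorem exists_orderOf_eq_of_exponent_eq [Fact p.Prime] {e : ℕ}
    (h : Monoid.exponent G = p ^ (e + 1)) : ∃ y : G, orderOf y = p ^ (e + 1) := by
  have hp := (Fact.out : p.Prime)
  by_contra! hne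
  have : Monoid.exponent G ∣ p ^ e := Monoid.exponent_dvd.2 fun g => by
    have hd : orderOf g ∣ p ^ (e + 1) := h ▸ Monoid.order_dvd_exponent g
    exact orderOf_dvd_of_lt_pow_succ hd
      (lt_of_le_of_ne (Nat.le_of_dvd (pow_pos hp.pos _) hd) (hne g))
  rw [h] at this
  have := (Nat.pow_dvd_pow_iff_le_right hp.one_lt).1 this
  omega

/-- The exponent of a group of GK type is `p` times that of its GK kernel; together with
`IsGKType.card_eq`, passing to the GK kernel thus preserves the cyclic deficiency. -/
theorem IsGKType.exponent_eq [Fact p.Prime] (h : IsGKType p G) :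
    Monoid.exponent G = p * Monoid.exponent (gkKernel G) := by
  have := h.1
  have hp := (Fact.out : p.Prime)
  obtain ⟨e, he⟩ := isPGroup_iff_exponent_eq_pow.1 h.2.1
  rcases e with _ | e
  · have := h.mem_gkKernel.1 (one_mem (gkKernel G))
    simp [he] at this
  obtain ⟨y, hy⟩ := exists_orderOf_eq_of_exponent_eq he
  have hyp : orderOf (y ^ p) = p ^ e := by
    rw [orderOf_pow_of_dvd hp.ne_zero (by rw [hy]; exact dvd_pow_self p (by omega)), hy, pow_succ,
      Nat.mul_div_cancel _ hp.pos]
  have hmem : y ^ p ∈ gkKernel G :=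
    h.mem_gkKernel.2 (by rw [hyp, he]; exact Nat.pow_lt_pow_right hp.one_lt (by omega))
  rw [he, pow_succ']
  congr 1
  apply Nat.dvd_antisymm
  · have := Monoid.order_dvd_exponent (⟨y ^ p, hmem⟩ : gkKernel G)
    rwa [Subgroup.orderOf_mk, hyp] at this
  · refine Monoid.exponent_dvd.2 fun g => ?_
    rw [← Subgroup.orderOf_coe]
    refine orderOf_dvd_of_lt_pow_succ (he ▸ Monoid.order_dvd_exponent _) ?_
    rw [← he]
    exact h.mem_gkKernel.1 g.2

/-- A group generated by elements of non-maximal order is not of GK type. -/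
theorem not_isGKType_of_closure_eq_top {s : Set G} (hs : s ⊆ gkSet G)
    (htop : Subgroup.closure s = ⊤) : ¬ IsGKType p G := fun h =>
  h.isCoatom.1 (top_le_iff.1 (htop ▸ (Subgroup.closure_le _).2
    (hs.trans h.coe_gkKernel.symm.subset)))

theorem not_isGKType_of_card_of_exponent_eq [Fact p.Prime] (hcard : Nat.card G = p ^ 2)
    (hexp : Monoid.exponent G = p) : ¬ IsGKType p G := by
  intro h
  have hp := (Fact.out : p.Prime)
  have h1 := h.card_eq
  have h2 := h.exponent_eq
  rw [hexp] at h2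
  have h3 : Monoid.exponent (gkKernel G) = 1 :=
    Nat.eq_of_mul_eq_mul_left hp.pos (by rw [← h2, mul_one])
  have := Monoid.exp_eq_one_iff.1 h3
  rw [hcard, Nat.card_of_subsingleton (1 : gkKernel G), mul_one, sq] at h1
  exact hp.one_lt.ne' (Nat.eq_of_mul_eq_mul_left hp.pos (by rw [h1, mul_one]))

/-- A group on level `l` whose GK root has order `p ^ 2` and exponent `p` has order `p ^ (l + 2)`
and exponent `p ^ (l + 1)`. -/
theorem HasGKRoot.card_and_exponent [Fact p.Prime] {l : ℕ} (hR : Nat.card R = p ^ 2)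
    (hexp : Monoid.exponent R = p) (h : HasGKRoot p G R l) :
    Nat.card G = p ^ (l + 2) ∧ Monoid.exponent G = p ^ (l + 1) := by
  induction l generalizing G with
  | zero =>
    obtain ⟨-, ⟨e⟩⟩ := hasGKRoot_zero_iff.1 h
    rw [Nat.card_congr e.toEquiv, Monoid.exponent_eq_of_mulEquiv e, hR, hexp]
    simp
  | succ l ih =>
    obtain ⟨h1, h2⟩ := hasGKRoot_succ_iff.1 h
    rw [h1.card_eq, h1.exponent_eq, (ih h2).1, (ih h2).2]
    exact ⟨(pow_succ' _ _).symm, (pow_succ' _ _).symm⟩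

end General

/-! ### Arithmetic of one-units -/

section Arithmetic

variable {p u : ℕ}

/-- The natural number `u` is a one-unit: `u ≡ 1` modulo `p`, and modulo `4` if `p = 2`. These are
the residues for which `u ↦ u ^ p` raises the `p`-adic valuation of `u - 1` by exactly one. -/
def IsOneUnit (p u : ℕ) : Prop := u ≡ 1 [MOD p] ∧ (p = 2 → u ≡ 1 [MOD 4])

theorem IsOneUnit.pow (h : IsOneUnit p u) (j : ℕ) : IsOneUnit p (u ^ j) :=
  ⟨by simpa using h.1.pow j, fun hp => by simpa using (h.2 hp).pow j⟩

theorem isOneUnit_one : IsOneUnit p 1 := ⟨rfl, fun _ => rfl⟩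

theorem isOneUnit_one_add_pow {l : ℕ} (hl : 1 ≤ l) (hne : (p, l) ≠ (2, 1)) :
    IsOneUnit p (1 + p ^ l) := by
  constructor
  · simpa using (Nat.modEq_zero_iff_dvd.2 (dvd_pow_self p (by omega : l ≠ 0))).add_left 1
  · rintro rfl
    have hl2 : 2 ≤ l := by
      by_contra h
      exact hne (by rw [show l = 1 by omega])
    simpa using (Nat.modEq_zero_iff_dvd.2 (pow_dvd_pow 2 hl2)).add_left 1

/-- The norm `1 + u + ⋯ + u ^ (p - 1)` of a one-unit is `p` times a unit. -/
theorem IsOneUnit.geom_sum [Fact p.Prime] (h : IsOneUnit p u) :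
    ∃ c, ∑ t ∈ Finset.range p, u ^ t = p * (1 + p * c) := by
  have hp := (Fact.out : p.Prime)
  have hu : 1 ≤ u := by
    rcases Nat.eq_zero_or_pos u with rfl | h0
    · exact absurd ((Nat.modEq_iff_dvd' (Nat.zero_le 1)).1 h.1) (by simpa using hp.one_lt.ne')
    · exact h0
  obtain ⟨b, hb⟩ := (Nat.modEq_iff_dvd' hu).1 h.1.symm
  obtain rfl : u = 1 + p * b := by omega
  have hge : p ≤ ∑ t ∈ Finset.range p, (1 + p * b) ^ t := by
    calc p = ∑ t ∈ Finset.range p, 1 := by simp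
      _ ≤ _ := Finset.sum_le_sum fun t _ => Nat.one_le_pow _ _ hu
  have hdvd : p ^ 2 ∣ ∑ t ∈ Finset.range p, (1 + p * b) ^ t - p := by
    rcases hp.eq_two_or_odd' with rfl | hodd
    · have := (Nat.modEq_iff_dvd' hu).1 (h.2 rfl).symm
      simp only [Finset.sum_range_succ, Finset.sum_range_zero, pow_zero, pow_one]
      omega
    · have := odd_sq_dvd_geom_sum₂_sub (R := ℤ) (1 : ℤ) (b : ℤ) hodd
      simp only [one_pow, mul_one] at this
      zify [hge]
      exact this
  obtain ⟨c, hc⟩ := hdvd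
  exact ⟨c, by rw [mul_add, mul_one, ← mul_assoc, ← sq, ← hc]; omega⟩

/-- A one-unit whose order modulo `p ^ (l + 1)` divides `p` is `1` modulo `p ^ l`. -/
theorem IsOneUnit.modEq_one [Fact p.Prime] {l : ℕ} (h : IsOneUnit p u)
    (hpow : u ^ p ≡ 1 [MOD p ^ (l + 1)]) : u ≡ 1 [MOD p ^ l] := by
  have hp := (Fact.out : p.Prime)
  obtain ⟨c, hc⟩ := h.geom_sum
  have h1 := (Nat.modEq_iff_dvd.1 hpow.symm)
  have h2 := geom_sum_mul (u : ℤ) p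
  have h3 : (∑ t ∈ Finset.range p, (u : ℤ) ^ t) = p * (1 + p * c) := by exact_mod_cast hc
  push_cast at h1
  rw [← h2, h3, pow_succ', mul_assoc] at h1
  have h4 := Int.dvd_of_mul_dvd_mul_left (by exact_mod_cast hp.ne_zero) h1
  have h5 : IsCoprime ((p : ℤ) ^ l) (1 + p * c) := by
    refine IsCoprime.pow_left ⟨-c, 1, by ring⟩
  refine (Nat.modEq_iff_dvd.2 ?_).symm
  push_cast
  exact h5.dvd_of_dvd_mul_left h4

end Arithmetic

/-! ### Split pairs -/

section SplitPair

variable {p l u : ℕ} {G H : Type*} [Group G] [Group H] {x y : G}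

theorem pow_mul_eq (h : y * x = x * y ^ u) (i : ℕ) : y ^ i * x = x * y ^ (i * u) := by
  induction i with
  | zero => simp
  | succ i ih => rw [pow_succ, mul_assoc, h, ← mul_assoc, ih, mul_assoc, ← pow_add, Nat.succ_mul]

theorem pow_mul_pow_eq (h : y * x = x * y ^ u) (i j : ℕ) :
    y ^ i * x ^ j = x ^ j * y ^ (i * u ^ j) := by
  induction j with
  | zero => simp
  | succ j ih =>
    rw [pow_succ, ← mul_assoc, ih, mul_assoc, pow_mul_eq h, ← mul_assoc, pow_succ u, mul_assoc i]

theorem mul_pow_eq (h : y * x = x * y ^ u) (i n : ℕ) :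
    (x * y ^ i) ^ n = x ^ n * y ^ (i * ∑ t ∈ Finset.range n, u ^ t) := by
  induction n with
  | zero => simp
  | succ n ih =>
    rw [pow_succ, ih, mul_assoc, ← mul_assoc _ x, pow_mul_eq h, mul_assoc, ← pow_add,
      ← mul_assoc, ← pow_succ, geom_sum_succ]
    congr 2
    ring

/-- The elements `y` and `x` generate a split extension of a cyclic group `⟨y⟩` of order
`p ^ (l + 1)` by the group `⟨x⟩` of order `p`, where `x⁻¹ y x = y ^ u`. -/
structure IsSplitPair (p l u : ℕ) (y x : G) : Prop where
  orderOf_left : orderOf y = p ^ (l + 1)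
  pow_right : x ^ p = 1
  notMem : x ∉ Subgroup.zpowers y
  conj : y * x = x * y ^ u

theorem IsSplitPair.pow_modEq (h : IsSplitPair p l u y x) : u ^ p ≡ 1 [MOD p ^ (l + 1)] := by
  have := pow_mul_pow_eq h.conj 1 p
  rw [h.pow_right, mul_one, one_mul, one_mul, pow_eq_pow_iff_modEq, h.orderOf_left] at this
  exact this.symm

/-- The inverse of the action of the generator of `C m` is multiplication by `U`. -/
theorem powAction_inv_one (n m : ℕ) (U : (ZMod n)ˣ) (hU : U ^ m = 1) (a : C n) :
    (powAction n m U hU (Multiplicative.ofAdd 1))⁻¹ a =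
      Multiplicative.ofAdd ((U : ZMod n) * a.toAdd) := by
  apply SemidirectProduct.inl_injective (φ := powAction n m U hU)
  rw [SemidirectProduct.inl_aut_inv, map_inv]
  exact CyclicSplit.conj n m U hU a.toAdd

theorem orderOf_ofAdd_one (n : ℕ) : orderOf (Multiplicative.ofAdd (1 : ZMod n)) = n := by
  rw [orderOf_ofAdd_eq_addOrderOf, ZMod.addOrderOf_one]

theorem mem_zpowers_ofAdd_one (n : ℕ) (a : C n) :
    a ∈ Subgroup.zpowers (Multiplicative.ofAdd (1 : ZMod n)) := by
  obtain ⟨k, hk⟩ := ZMod.intCast_surjective a.toAdd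
  refine ⟨k, ?_⟩
  apply Multiplicative.toAdd.injective
  simp [hk]

/-- The homomorphism from the cyclic group of order `n` mapping the generator to `g`. -/
noncomputable def cyclicLift (n : ℕ) (g : G) (hg : g ^ n = 1) : C n →* G :=
  AddMonoidHom.toMultiplicativeLeft (ZMod.lift n ⟨zmultiplesHom (Additive G) (Additive.ofMul g), by
    simpa using congrArg Additive.ofMul hg⟩)

theorem cyclicLift_one (n : ℕ) (g : G) (hg : g ^ n = 1) :
    cyclicLift n g hg (Multiplicative.ofAdd 1) = g := by
  have := ZMod.lift_coe n ⟨zmultiplesHom (Additive G) (Additive.ofMul g), by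
    simpa using congrArg Additive.ofMul hg⟩ 1
  simp at this
  simp [cyclicLift, this]

theorem cyclicLift_injective {n : ℕ} {g : G} (hg : orderOf g = n) :
    Function.Injective (cyclicLift n g (by rw [← hg, pow_orderOf_eq_one])) := by
  rw [injective_iff_map_eq_one]
  intro a ha
  obtain ⟨k, rfl⟩ := mem_zpowers_ofAdd_one n a
  simp only [map_zpow, cyclicLift_one] at ha
  rw [← orderOf_dvd_iff_zpow_eq_one, hg] at ha
  simp only
  rwa [← orderOf_dvd_iff_zpow_eq_one, orderOf_ofAdd_one]

/-- A group of order `p ^ (l + 2)` containing a split pair is the corresponding split extension. -/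
theorem IsSplitPair.exists_mulEquiv [Fact p.Prime] [Finite G] (h : IsSplitPair p l u y x)
    (hcard : Nat.card G = p ^ (l + 2)) (U : (ZMod (p ^ (l + 1)))ˣ) (hU : U ^ p = 1)
    (hu : (U : ZMod (p ^ (l + 1))) = u) :
    ∃ e : CyclicSplit (p ^ (l + 1)) p U hU ≃* G,
      e (SemidirectProduct.inl (Multiplicative.ofAdd 1)) = y ∧
      e (SemidirectProduct.inr (Multiplicative.ofAdd 1)) = x := by
  have hp := (Fact.out : p.Prime)
  have hx : orderOf x = p := orderOf_eq_prime h.pow_right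
    fun h1 => h.notMem (h1 ▸ one_mem _)
  set f : C (p ^ (l + 1)) →* G := cyclicLift _ y (by rw [← h.orderOf_left, pow_orderOf_eq_one])
    with hf
  set g : C p →* G := cyclicLift _ x h.pow_right with hg
  have hfy : f (Multiplicative.ofAdd 1) = y := cyclicLift_one ..
  have hgx : g (Multiplicative.ofAdd 1) = x := cyclicLift_one ..
  -- it suffices to check compatibility with the action for the generator of `C p`
  have hbase : ∀ a, f (powAction _ p U hU (Multiplicative.ofAdd 1) a) * x = x * f a := by
    intro a
    obtain ⟨b, rfl⟩ : ∃ b, (powAction _ p U hU (Multiplicative.ofAdd 1))⁻¹ b = a :=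
      ⟨powAction _ p U hU (Multiplicative.ofAdd 1) a, MulEquiv.symm_apply_apply _ _⟩
    rw [MulAut.apply_inv_self, powAction_inv_one, hu]
    obtain ⟨k, rfl⟩ := (mem_powers_iff_mem_zpowers).2 (mem_zpowers_ofAdd_one _ b)
    have h1 : Multiplicative.ofAdd ((u : ZMod (p ^ (l + 1))) * Multiplicative.toAdd
        (Multiplicative.ofAdd (1 : ZMod (p ^ (l + 1))) ^ k)) =
        Multiplicative.ofAdd 1 ^ (k * u) := by
      apply Multiplicative.toAdd.injective
      simp [mul_comm]
    simp only [h1, map_pow, hfy]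
    exact pow_mul_eq h.conj k
  have hcompat : ∀ b, f.comp (powAction _ p U hU b).toMonoidHom =
      (MulAut.conj (g b)).toMonoidHom.comp f := by
    intro b
    obtain ⟨k, rfl⟩ := (mem_powers_iff_mem_zpowers).2 (mem_zpowers_ofAdd_one _ b)
    simp only [map_pow, hgx]
    induction k with
    | zero => rfl
    | succ k ih =>
      refine MonoidHom.ext fun a => ?_
      have h1 := DFunLike.congr_fun ih (powAction _ p U hU (Multiplicative.ofAdd 1) a)
      simp only [MonoidHom.comp_apply, MulEquiv.coe_toMonoidHom, pow_succ, MulAut.mul_apply] at h1 ⊢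
      rw [h1, eq_mul_inv_of_mul_eq (hbase a), MulAut.conj_apply]
  let F := SemidirectProduct.lift f g hcompat
  -- a relation `f a * g b = 1` puts `g b` into `⟨y⟩`, which meets `⟨x⟩` trivially
  have hinj : Function.Injective F := by
    rw [injective_iff_map_eq_one]
    intro z hz
    rw [← SemidirectProduct.inl_left_mul_inr_right z] at hz ⊢
    rw [map_mul, SemidirectProduct.lift_inl, SemidirectProduct.lift_inr] at hz
    obtain ⟨k, hk⟩ := mem_zpowers_ofAdd_one _ z.left
    obtain ⟨m, hm⟩ := (mem_powers_iff_mem_zpowers).2 (mem_zpowers_ofAdd_one _ z.right)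
    simp only at hk hm
    have hxm : x ^ m ∈ Subgroup.zpowers y := by
      rw [← hk, ← hm, map_zpow, map_pow, hfy, hgx] at hz
      rw [← inv_eq_of_mul_eq_one_right hz]
      exact inv_mem (Subgroup.zpow_mem _ (Subgroup.mem_zpowers y) k)
    have hpm : p ∣ m := by
      by_contra hpm
      apply h.notMem
      have hcop : (m).Coprime (orderOf x) := by
        rw [hx]
        exact ((Nat.Prime.coprime_iff_not_dvd hp).2 hpm).symm
      obtain ⟨j, hj⟩ := exists_pow_eq_self_of_coprime hcop
      rw [← hj]
      exact Subgroup.pow_mem _ hxm j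
    have hright : z.right = 1 := by
      rw [← hm, ← orderOf_dvd_iff_pow_eq_one, orderOf_ofAdd_one]
      exact hpm
    rw [hright, map_one, mul_one] at hz
    rw [hright, map_one, mul_one,
      (injective_iff_map_eq_one f).1 (cyclicLift_injective h.orderOf_left) _ hz, map_one]
  have hbij : Function.Bijective F := (Nat.bijective_iff_injective_and_card F).2 ⟨hinj, by
    rw [SemidirectProduct.card, hcard, Nat.card_eq_fintype_card, Nat.card_eq_fintype_card]
    simp [ZMod.card, ← pow_succ]⟩
  exact ⟨MulEquiv.ofBijective F hbij, by simp [F, hfy], by simp [F, hgx]⟩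

theorem IsSplitPair.exists_unit [Fact p.Prime] (h : IsSplitPair p l u y x) :
    ∃ U : (ZMod (p ^ (l + 1)))ˣ, U ^ p = 1 ∧ (U : ZMod (p ^ (l + 1))) = u := by
  have h1 : (u : ZMod (p ^ (l + 1))) ^ p = 1 := by
    have := (ZMod.natCast_eq_natCast_iff _ _ _).2 h.pow_modEq
    simpa using this
  exact ⟨Units.ofPowEqOne _ p h1 (Fact.out : p.Prime).ne_zero, Units.pow_ofPowEqOne _ _, rfl⟩

theorem IsSplitPair.nonempty_mulEquiv [Fact p.Prime] [Finite G] [Finite H]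
    (h : IsSplitPair p l u y x) (hG : Nat.card G = p ^ (l + 2)) {y' x' : H}
    (h' : IsSplitPair p l u y' x') (hH : Nat.card H = p ^ (l + 2)) : Nonempty (G ≃* H) := by
  obtain ⟨U, hU, hu⟩ := h.exists_unit
  obtain ⟨e, -⟩ := h.exists_mulEquiv hG U hU hu
  obtain ⟨e', -⟩ := h'.exists_mulEquiv hH U hU hu
  exact ⟨e.symm.trans e'⟩

theorem IsSplitPair.exists_pow_mul_pow [Fact p.Prime] [Finite G] (h : IsSplitPair p l u y x)
    (hcard : Nat.card G = p ^ (l + 2)) (g : G) : ∃ j i : ℕ, g = x ^ j * y ^ i := by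
  obtain ⟨U, hU, hu⟩ := h.exists_unit
  obtain ⟨e, hy, hx⟩ := h.exists_mulEquiv hcard U hU hu
  obtain ⟨z, rfl⟩ := e.surjective g
  obtain ⟨i, hi⟩ := (mem_powers_iff_mem_zpowers).2 (mem_zpowers_ofAdd_one _ z.left)
  obtain ⟨j, hj⟩ := (mem_powers_iff_mem_zpowers).2 (mem_zpowers_ofAdd_one _ z.right)
  refine ⟨j, i * u ^ j, ?_⟩
  simp only at hi hj
  rw [← pow_mul_pow_eq h.conj, ← SemidirectProduct.inl_left_mul_inr_right z, ← hi, ← hj]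
  simp only [map_mul, map_pow, hx, hy]

end SplitPair

/-! ### Split pairs in the stem groups and the bush groups -/

section Models

variable {p l u : ℕ} {G : Type*} [Group G] {x y : G}

theorem card_C (n : ℕ) [NeZero n] : Nat.card (C n) = n := by
  rw [Nat.card_eq_fintype_card]
  simp [ZMod.card]

theorem card_stemGroup (p l : ℕ) [Fact p.Prime] : Nat.card (StemGroup p l) = p ^ (l + 2) := by
  rw [Nat.card_prod, card_C, card_C, ← pow_succ']

theorem card_bushGroup [Fact p.Prime] (hl : 1 ≤ l) :
    Nat.card (BushGroup p l hl) = p ^ (l + 2) := by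
  rw [SemidirectProduct.card, card_C, card_C, ← pow_succ]

theorem isSplitPair_stemGroup (p l : ℕ) [Fact p.Prime] :
    IsSplitPair p l 1 ((1, Multiplicative.ofAdd 1) : StemGroup p l)
      (Multiplicative.ofAdd 1, 1) where
  orderOf_left := by rw [Prod.orderOf_mk, orderOf_one, orderOf_ofAdd_one, Nat.lcm_one_left]
  pow_right := by
    refine Prod.ext ?_ (one_pow _)
    exact orderOf_dvd_iff_pow_eq_one.1 (orderOf_ofAdd_one p).dvd
  notMem := by
    rintro ⟨k, hk⟩
    have h1 := congrArg Prod.fst hk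
    simp only [Prod.pow_fst, one_zpow] at h1
    have h2 := orderOf_ofAdd_one p
    rw [← h1, orderOf_one] at h2
    exact (Fact.out : p.Prime).one_lt.ne h2
  conj := by rw [pow_one, mul_comm]

theorem isSplitPair_bushGroup [Fact p.Prime] (hl : 1 ≤ l) :
    IsSplitPair p l (1 + p ^ l)
      (SemidirectProduct.inl (Multiplicative.ofAdd 1) : BushGroup p l hl)
      (SemidirectProduct.inr (Multiplicative.ofAdd 1)) where
  orderOf_left := by
    rw [orderOf_injective _ SemidirectProduct.inl_injective, orderOf_ofAdd_one]
  pow_right := by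
    rw [← map_pow, orderOf_dvd_iff_pow_eq_one.1 (orderOf_ofAdd_one p).dvd, map_one]
  notMem := by
    rintro ⟨k, hk⟩
    have h1 := congrArg SemidirectProduct.rightHom hk
    simp only [map_zpow, SemidirectProduct.rightHom_inl, SemidirectProduct.rightHom_inr,
      one_zpow] at h1
    have h2 := orderOf_ofAdd_one p
    rw [← h1, orderOf_one] at h2
    exact (Fact.out : p.Prime).one_lt.ne h2
  conj := by
    have h := CyclicSplit.conj (p ^ (l + 1)) p
      (Units.ofPowEqOne _ p (bushUnit_pow p l hl) (Fact.out : p.Prime).ne_zero)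
      (Units.pow_ofPowEqOne _ _) 1
    rw [mul_assoc, inv_mul_eq_iff_eq_mul] at h
    rw [h, ← map_pow]
    congr 2
    apply Multiplicative.toAdd.injective
    simp

theorem IsSplitPair.nonempty_mulEquiv_stemGroup [Fact p.Prime] [Finite G]
    (h : IsSplitPair p l 1 y x) (hG : Nat.card G = p ^ (l + 2)) :
    Nonempty (G ≃* StemGroup p l) :=
  h.nonempty_mulEquiv hG (isSplitPair_stemGroup p l) (card_stemGroup p l)

theorem IsSplitPair.nonempty_mulEquiv_bushGroup [Fact p.Prime] [Finite G] (hl : 1 ≤ l)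
    (h : IsSplitPair p l (1 + p ^ l) y x) (hG : Nat.card G = p ^ (l + 2)) :
    Nonempty (G ≃* BushGroup p l hl) :=
  h.nonempty_mulEquiv hG (isSplitPair_bushGroup hl) (card_bushGroup hl)

theorem IsSplitPair.not_commutative [Fact p.Prime] (h : IsSplitPair p l (1 + p ^ l) y x) :
    ¬ ∀ a b : G, a * b = b * a := by
  intro hcomm
  have h1 := h.conj
  rw [hcomm, mul_right_inj, pow_add, pow_one, left_eq_mul, ← orderOf_dvd_iff_pow_eq_one,
    h.orderOf_left, Nat.pow_dvd_pow_iff_le_right (Fact.out : p.Prime).one_lt] at h1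
  omega

/-! ### The GK kernel of a split extension -/

/-- For a one-unit `u`, the `p`-th power of `x ^ j * y ^ i` is `y ^ (i * p)` up to a `p`-adic
one-unit in the exponent, and this factor disappears in the last nontrivial power. -/
theorem IsSplitPair.pow_eq [Fact p.Prime] (h : IsSplitPair p (l + 1) u y x) (hu : IsOneUnit p u)
    (j i : ℕ) : (x ^ j * y ^ i) ^ p ^ (l + 1) = y ^ (i * p ^ (l + 1)) := by
  obtain ⟨c, hc⟩ := (hu.pow j).geom_sum
  have hconj : y * x ^ j = x ^ j * y ^ (u ^ j) := by simpa using pow_mul_pow_eq h.conj 1 j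
  rw [pow_succ', pow_mul, mul_pow_eq hconj, hc, ← pow_mul, mul_comm j, pow_mul,
    h.pow_right, one_pow, one_mul, ← pow_mul, pow_eq_pow_iff_modEq, h.orderOf_left,
    show i * (p * (1 + p * c)) * p ^ l = i * (p * p ^ l) + p ^ (l + 1 + 1) * (i * c) by ring]
  simp [Nat.ModEq]

theorem IsSplitPair.exponent_eq [Fact p.Prime] [Finite G] (h : IsSplitPair p (l + 1) u y x)
    (hu : IsOneUnit p u) (hG : Nat.card G = p ^ (l + 3)) :
    Monoid.exponent G = p ^ (l + 2) := by
  apply Nat.dvd_antisymm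
  · refine Monoid.exponent_dvd_of_forall_pow_eq_one fun g => ?_
    obtain ⟨j, i, rfl⟩ := h.exists_pow_mul_pow hG g
    rw [pow_succ, pow_mul, h.pow_eq hu, ← pow_mul, mul_assoc, ← pow_succ,
      mul_comm, pow_mul, orderOf_dvd_iff_pow_eq_one.1 h.orderOf_left.dvd, one_pow]
  · rw [← h.orderOf_left]
    exact Monoid.order_dvd_exponent y

/-- In a split extension by a one-unit, `g ↦ g ^ p ^ l` is a homomorphism with image of order `p`,
and its kernel consists of the elements of non-maximal order. -/
theorem IsSplitPair.exists_powHom [Fact p.Prime] [Finite G] (h : IsSplitPair p (l + 1) u y x)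
    (hu : IsOneUnit p u) (hG : Nat.card G = p ^ (l + 3)) :
    ∃ φ : G →* G, (∀ g, φ g = g ^ p ^ (l + 1)) ∧ φ.ker.index = p ∧ (φ.ker : Set G) = gkSet G := by
  have hp := (Fact.out : p.Prime)
  have hpow : ∀ j i : ℕ, (x ^ j * y ^ i) ^ p ^ (l + 1) = y ^ (i * p ^ (l + 1)) :=
    h.pow_eq hu
  let φ : G →* G := MonoidHom.mk' (fun g => g ^ p ^ (l + 1)) fun a b => by
    obtain ⟨j, i, rfl⟩ := h.exists_pow_mul_pow hG a
    obtain ⟨k, m, rfl⟩ := h.exists_pow_mul_pow hG b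
    have h1 : x ^ j * y ^ i * (x ^ k * y ^ m) = x ^ (j + k) * y ^ (i * u ^ k + m) := by
      rw [mul_assoc, ← mul_assoc (y ^ i), pow_mul_pow_eq h.conj, pow_add, pow_add]
      simp only [mul_assoc]
    rw [h1, hpow, hpow, hpow, ← pow_add, pow_eq_pow_iff_modEq, h.orderOf_left, ← add_mul,
      pow_succ' p (l + 1)]
    refine Nat.ModEq.mul_right' _ (Nat.ModEq.add_right _ ?_)
    simpa using (hu.pow k).1.mul_left i
  have hφ : ∀ g, φ g = g ^ p ^ (l + 1) := fun g => rfl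
  refine ⟨φ, hφ, ?_, ?_⟩
  · have hrange : φ.range = Subgroup.zpowers (y ^ p ^ (l + 1)) := by
      apply le_antisymm
      · rintro _ ⟨g, rfl⟩
        obtain ⟨j, i, rfl⟩ := h.exists_pow_mul_pow hG g
        rw [hφ, hpow, mul_comm, pow_mul]
        exact Subgroup.pow_mem _ (Subgroup.mem_zpowers _) _
      · rw [Subgroup.zpowers_le]
        exact ⟨y, hφ y⟩
    rw [Subgroup.index_ker, hrange, Nat.card_zpowers, orderOf_pow_of_dvd (pow_pos hp.pos _).ne'
      (h.orderOf_left ▸ pow_dvd_pow p (by omega)), h.orderOf_left, pow_succ,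
      Nat.mul_div_cancel_left _ (pow_pos hp.pos _)]
  · ext g
    rw [SetLike.mem_coe, MonoidHom.mem_ker, hφ, gkSet, Set.mem_ofPred_eq, h.exponent_eq hu hG,
      ← orderOf_dvd_iff_pow_eq_one]
    constructor
    · intro hg
      exact (Nat.le_of_dvd (pow_pos hp.pos _) hg).trans_lt
        (Nat.pow_lt_pow_right hp.one_lt (by omega))
    · exact orderOf_dvd_of_lt_pow_succ (h.exponent_eq hu hG ▸ Monoid.order_dvd_exponent g)

/-- A split extension by a one-unit is of GK type, and its GK kernel is `⟨y ^ p⟩ × ⟨x⟩`. -/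
theorem IsSplitPair.isGKType [Fact p.Prime] [Finite G] (h : IsSplitPair p (l + 1) u y x)
    (hu : IsOneUnit p u) (hG : Nat.card G = p ^ (l + 3)) :
    IsGKType p G ∧ Nonempty (gkKernel G ≃* StemGroup p l) := by
  have hp := (Fact.out : p.Prime)
  obtain ⟨φ, hφ, hindex, hker⟩ := h.exists_powHom hu hG
  have hGK : IsGKType p G := ⟨inferInstance, IsPGroup.of_card hG, φ.ker,
    isCoatom_of_index_eq hindex, hker⟩
  refine ⟨hGK, ?_⟩
  have hmem : ∀ g, g ∈ gkKernel G ↔ g ^ p ^ (l + 1) = 1 := fun g => by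
    rw [← SetLike.mem_coe, hGK.coe_gkKernel, ← hker, SetLike.mem_coe, MonoidHom.mem_ker, hφ]
  have hypow : y ^ p ^ (l + 2) = 1 := orderOf_dvd_iff_pow_eq_one.1 h.orderOf_left.dvd
  have hy : y ^ p ∈ gkKernel G := (hmem _).2 (by rw [← pow_mul, ← pow_succ', hypow])
  have hx : x ∈ gkKernel G := (hmem _).2 (by rw [pow_succ', pow_mul, h.pow_right, one_pow])
  have hpair : IsSplitPair p l 1 (⟨y ^ p, hy⟩ : gkKernel G) ⟨x, hx⟩ := by
    refine ⟨?_, Subtype.ext h.pow_right, ?_, Subtype.ext ?_⟩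
    · rw [Subgroup.orderOf_mk, orderOf_pow_of_dvd hp.ne_zero
        (h.orderOf_left ▸ dvd_pow_self p (by omega)), h.orderOf_left, pow_succ,
        Nat.mul_div_cancel _ hp.pos]
    · rintro ⟨k, hk⟩
      have h1 := congrArg Subtype.val hk
      simp only [SubgroupClass.coe_zpow] at h1
      exact h.notMem (h1 ▸ Subgroup.zpow_mem _ (Subgroup.pow_mem _ (Subgroup.mem_zpowers y) p) k)
    · simp only [pow_one, Subgroup.coe_mul]
      rw [pow_mul_eq h.conj, mul_right_inj, pow_eq_pow_iff_modEq, h.orderOf_left,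
        pow_succ' p (l + 1)]
      simpa using (hu.modEq_one h.pow_modEq).mul_left' p
  refine hpair.nonempty_mulEquiv_stemGroup ?_
  have := hGK.card_eq
  rw [hG, pow_succ'] at this
  exact (Nat.eq_of_mul_eq_mul_left hp.pos this).symm

end Models

/-! ### Classification of the groups of cyclic deficiency one -/

section Classification

variable {p l u : ℕ} {G : Type*} [Group G] {x y : G}

theorem exists_one_add_mul_pow (a j : ℕ) : ∃ N, (1 + a) ^ j = 1 + j * a + a ^ 2 * N := by
  induction j with
  | zero => exact ⟨0, by simp⟩
  | succ j ih =>
    obtain ⟨N, hN⟩ := ih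
    exact ⟨j + N + a * N, by rw [pow_succ, hN]; ring⟩

/-- The elements outside a normal cyclic subgroup `⟨y⟩` of index `p` act on it by raising to a
power `u` with `u ≡ 1` modulo `p`. -/
theorem exists_mul_eq_mul_pow [Fact p.Prime] [Finite G] (hy : orderOf y = p ^ (l + 1))
    (hA : (Subgroup.zpowers y).index = p) (hn : (Subgroup.zpowers y).Normal) (x : G) :
    ∃ u, y * x = x * y ^ u ∧ u ≡ 1 [MOD p] := by
  have hp := (Fact.out : p.Prime)
  obtain ⟨u, hu⟩ := mem_powers_iff_mem_zpowers.2
    (hn.conj_mem y (Subgroup.mem_zpowers y) x⁻¹)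
  have hconj : y * x = x * y ^ u := by
    simp only at hu
    rw [hu]
    group
  refine ⟨u, hconj, ?_⟩
  obtain ⟨m, hm⟩ := mem_powers_iff_mem_zpowers.2
    ((Subgroup.zpowers y).pow_index_mem x)
  simp only [hA] at hm
  have h1 := pow_mul_pow_eq hconj 1 p
  rw [← hm, one_mul, ← pow_add, ← pow_add, add_comm, pow_eq_pow_iff_modEq, hy] at h1
  -- `x ^ p` lies in `⟨y⟩`, so it centralizes `y`
  have h2 : 1 ≡ u ^ p [MOD p] :=
    (Nat.ModEq.add_left_cancel' m h1).of_dvd (dvd_pow_self p (by omega))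
  have h3 := (ZMod.natCast_eq_natCast_iff _ _ _).2 h2
  rw [Nat.cast_pow, ZMod.pow_card] at h3
  exact ((ZMod.natCast_eq_natCast_iff _ _ _).1 h3).symm

/-- In a `2`-group of GK type with cyclic subgroup `⟨y⟩` of index `2`, some element of the GK
kernel acts on `⟨y⟩` by a one-unit. This rules out inversion and its relatives, which occur in the
dihedral, quaternion and semidihedral groups. -/
theorem exists_isOneUnit_of_isGKType [Finite G] (hl : 1 ≤ l) (hy : orderOf y = 2 ^ (l + 1))
    (hA : (Subgroup.zpowers y).index = 2) (hn : (Subgroup.zpowers y).Normal)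
    (hexp : Monoid.exponent G = 2 ^ (l + 1)) (hGK : IsGKType 2 G) :
    ∃ x ∉ Subgroup.zpowers y, ∃ u, y * x = x * y ^ u ∧ IsOneUnit 2 u := by
  have hyK : y ∉ gkKernel G := by
    rw [hGK.mem_gkKernel, hy, hexp]
    exact lt_irrefl _
  obtain ⟨x, hxK, hxA⟩ : ∃ x ∈ gkKernel G, x ∉ Subgroup.zpowers y := by
    by_contra! h
    have h1 : Subgroup.zpowers y = gkKernel G := by
      rcases (le_iff_lt_or_eq.1 (show gkKernel G ≤ Subgroup.zpowers y from h)) with h2 | h2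
      · have h3 := hGK.isCoatom.2 _ h2
        rw [h3, Subgroup.index_top] at hA
        omega
      · exact h2.symm
    exact hyK (h1 ▸ Subgroup.mem_zpowers y)
  obtain ⟨u, hu, hu2⟩ := exists_mul_eq_mul_pow hy hA hn x
  refine ⟨x, hxA, u, hu, hu2, fun _ => ?_⟩
  obtain ⟨m, hm⟩ := mem_powers_iff_mem_zpowers.2
    ((Subgroup.zpowers y).pow_index_mem x)
  simp only [hA] at hm
  obtain ⟨k, rfl⟩ : ∃ k, l = k + 1 := ⟨l - 1, by omega⟩
  -- `x ^ 2 = y ^ m` with `4 ∣ m`, since `x` has non-maximal order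
  have h1 : 4 ∣ m := by
    have h := orderOf_dvd_of_lt_pow_succ (hexp ▸ Monoid.order_dvd_exponent x)
      (hexp ▸ hGK.mem_gkKernel.1 hxK)
    rw [orderOf_dvd_iff_pow_eq_one, pow_succ', pow_mul, ← hm, ← pow_mul,
      ← orderOf_dvd_iff_pow_eq_one, hy, show 2 ^ (k + 1 + 1) = 4 * 2 ^ k by ring] at h
    exact Nat.dvd_of_mul_dvd_mul_right (by positivity) h
  -- `(x * y) ^ 2 = y ^ (m + 1 + u)` with `¬ 4 ∣ m + 1 + u`, since `x * y` has maximal order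
  have h2 : ¬ 4 ∣ m + (1 + u) := by
    intro h
    have hxy : x * y ∉ gkKernel G := fun hxy => hyK ((Subgroup.mul_mem_cancel_left _ hxK).1 hxy)
    apply hxy
    rw [hGK.mem_gkKernel, hexp]
    have h3 := mul_pow_eq hu 1 2
    rw [← hm, pow_one, one_mul, ← pow_add, Finset.sum_range_succ, Finset.sum_range_one, pow_zero,
      pow_one] at h3
    refine (Nat.le_of_dvd (by positivity)
      (orderOf_dvd_of_pow_eq_one (n := 2 ^ (k + 1)) ?_)).trans_lt
      (Nat.pow_lt_pow_right (by norm_num) (by omega))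
    rw [pow_succ', pow_mul, h3, ← pow_mul, ← orderOf_dvd_iff_pow_eq_one, hy,
      show 2 ^ (k + 1 + 1) = 4 * 2 ^ k by ring]
    exact Nat.mul_dvd_mul_right h _
  have h3 : u % 2 = 1 := hu2
  change u % 4 = 1 % 4
  omega

/-- The extension by a one-unit splits: the norm of a one-unit is `p` times a unit, so the `p`-th
power of `x` can be corrected by a power of `y`. -/
theorem exists_isSplitPair_of_isOneUnit [Fact p.Prime] [Finite G] (hy : orderOf y = p ^ (l + 1))
    (hA : (Subgroup.zpowers y).index = p) (hn : (Subgroup.zpowers y).Normal)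
    (hexp : Monoid.exponent G = p ^ (l + 1)) (hx : x ∉ Subgroup.zpowers y)
    (hconj : y * x = x * y ^ u) (hu : IsOneUnit p u) : ∃ z : G, IsSplitPair p l u y z := by
  have hp := (Fact.out : p.Prime)
  obtain ⟨c, hc⟩ := hu.geom_sum
  obtain ⟨m, hm⟩ := mem_powers_iff_mem_zpowers.2
    ((Subgroup.zpowers y).pow_index_mem x)
  simp only [hA] at hm
  -- otherwise `x` would have order `p ^ (l + 2)`
  obtain ⟨m, rfl⟩ : p ∣ m := by
    have h := hexp ▸ Monoid.pow_exponent_eq_one x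
    rw [pow_succ', pow_mul, ← hm, ← pow_mul, ← orderOf_dvd_iff_pow_eq_one, hy, pow_succ'] at h
    exact Nat.dvd_of_mul_dvd_mul_right (pow_pos hp.pos _) h
  obtain ⟨i, hi⟩ : ∃ i, p ^ l ∣ m + i * (1 + p * c) := by
    have hcop : (1 + p * c).Coprime (p ^ l) := by
      refine Nat.Coprime.pow_right l ?_
      simp
    have hunit := (ZMod.unitOfCoprime _ hcop).mul_inv
    have : NeZero (p ^ l) := ⟨(pow_pos hp.pos l).ne'⟩
    refine ⟨(-(m : ZMod (p ^ l)) * ((ZMod.unitOfCoprime _ hcop)⁻¹ : (ZMod (p ^ l))ˣ)).val, ?_⟩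
    rw [← ZMod.natCast_eq_zero_iff]
    rw [ZMod.coe_unitOfCoprime] at hunit
    rw [Nat.cast_add, Nat.cast_mul, ZMod.natCast_val, ZMod.cast_id', id, mul_assoc,
      mul_comm _ ((1 + p * c : ℕ) : ZMod (p ^ l)), hunit]
    ring
  refine ⟨x * y ^ i, hy, ?_, ?_, ?_⟩
  · rw [mul_pow_eq hconj, hc, ← hm, ← pow_add, ← orderOf_dvd_iff_pow_eq_one, hy,
      show p * m + i * (p * (1 + p * c)) = p * (m + i * (1 + p * c)) by ring, pow_succ']
    exact Nat.mul_dvd_mul_left p hi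
  · rwa [Subgroup.mul_mem_cancel_right _ (Subgroup.pow_mem _ (Subgroup.mem_zpowers y) i)]
  · rw [← mul_assoc, hconj, mul_assoc, mul_assoc, pow_mul_comm]

/-- Replacing `x` by a power, the exponent `u` becomes `1` or `1 + p ^ l`. -/
theorem IsSplitPair.normalize [Fact p.Prime] [Finite G] (hl : 1 ≤ l) (h : IsSplitPair p l u y x)
    (hu : IsOneUnit p u) :
    IsSplitPair p l 1 y x ∨
      (p, l) ≠ (2, 1) ∧ ∃ z : G, IsSplitPair p l (1 + p ^ l) y z := by
  have hp := (Fact.out : p.Prime)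
  have hpl : p ∣ p ^ l := dvd_pow_self p (by omega)
  have hone := hu.modEq_one h.pow_modEq
  have hu1 : 1 ≤ u := by
    rcases Nat.eq_zero_or_pos u with rfl | h0
    · exact absurd ((Nat.modEq_iff_dvd' (Nat.zero_le 1)).1 hu.1) (by simpa using hp.one_lt.ne')
    · exact h0
  obtain ⟨k, hk⟩ := (Nat.modEq_iff_dvd' hu1).1 hone.symm
  obtain rfl : u = 1 + p ^ l * k := by omega
  by_cases hpk : p ∣ k
  · left
    refine ⟨h.orderOf_left, h.pow_right, h.notMem, ?_⟩
    rw [h.conj, pow_one, pow_add, pow_one, mul_right_inj, mul_eq_left,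
      ← orderOf_dvd_iff_pow_eq_one, h.orderOf_left, pow_succ]
    exact Nat.mul_dvd_mul_left _ hpk
  · right
    constructor
    · intro heq
      obtain ⟨rfl, rfl⟩ := Prod.mk.inj heq
      have := hu.2 rfl
      simp only [Nat.ModEq, pow_one] at this
      omega
    · have hkp : k.Coprime p := ((Nat.Prime.coprime_iff_not_dvd hp).2 hpk).symm
      obtain ⟨j, hj⟩ : ∃ j, k * j ≡ 1 [MOD p] :=
        ⟨_, (Nat.exists_mul_mod_eq_one_of_coprime hkp hp.one_lt).choose_spec.2.trans
          (Nat.mod_eq_of_lt hp.one_lt).symm⟩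
      refine ⟨x ^ j, h.orderOf_left, ?_, fun hxj => ?_, ?_⟩
      · rw [← pow_mul, mul_comm, pow_mul, h.pow_right, one_pow]
      · apply h.notMem
        have hxp : orderOf x ∣ p := orderOf_dvd_of_pow_eq_one h.pow_right
        have h1 : x ^ (k * j) = x ^ 1 := pow_eq_pow_iff_modEq.2 (hj.of_dvd hxp)
        rw [pow_one, mul_comm, pow_mul] at h1
        rw [← h1]
        exact Subgroup.pow_mem _ hxj k
      · have h1 := pow_mul_pow_eq h.conj 1 j
        rw [pow_one, one_mul] at h1
        -- `(1 + p ^ l * k) ^ j = 1 + p ^ l * (k * j)` modulo `p ^ (l + 1)`, where `k * j ≡ 1`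
        obtain ⟨N, hN⟩ := exists_one_add_mul_pow (p ^ l * k) j
        rw [h1, mul_right_inj, pow_eq_pow_iff_modEq, h.orderOf_left, hN, pow_succ,
          show (p ^ l * k) ^ 2 * N = p ^ l * (p ^ l * (k ^ 2 * N)) by ring,
          show j * (p ^ l * k) = p ^ l * (k * j) by ring, add_assoc, ← mul_add]
        refine Nat.ModEq.add_left 1 ?_
        have h2 : p ^ l * (k ^ 2 * N) ≡ 0 [MOD p] :=
          Nat.modEq_zero_iff_dvd.2 (hpl.mul_right _)
        simpa using (hj.add h2).mul_left' (p ^ l)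

/-- A group of order `p ^ (l + 2)` and exponent `p ^ (l + 1)` that is of GK type if `p = 2` is a
stem group or a bush group. -/
theorem nonempty_mulEquiv_of_card_of_exponent [Fact p.Prime] [Finite G] (hl : 1 ≤ l)
    (hcard : Nat.card G = p ^ (l + 2)) (hexp : Monoid.exponent G = p ^ (l + 1))
    (h : p = 2 → IsGKType p G) :
    Nonempty (G ≃* StemGroup p l) ∨ (p, l) ≠ (2, 1) ∧ Nonempty (G ≃* BushGroup p l hl) := by
  have hp := (Fact.out : p.Prime)
  obtain ⟨y, hy⟩ := exists_orderOf_eq_of_exponent_eq hexp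
  have hA : (Subgroup.zpowers y).index = p := by
    have h1 := (Subgroup.zpowers y).card_mul_index
    rw [Nat.card_zpowers, hy, hcard, pow_succ p (l + 1)] at h1
    exact Nat.eq_of_mul_eq_mul_left (pow_pos hp.pos _) h1
  have hn := normal_of_isCoatom (IsPGroup.of_card hcard) (isCoatom_of_index_eq hA)
  obtain ⟨x, hx, u, hconj, hu⟩ :
      ∃ x ∉ Subgroup.zpowers y, ∃ u, y * x = x * y ^ u ∧ IsOneUnit p u := by
    by_cases hp2 : p = 2
    · subst hp2
      exact exists_isOneUnit_of_isGKType hl hy hA hn hexp (h rfl)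
    · obtain ⟨x, hx⟩ : ∃ x, x ∉ Subgroup.zpowers y := by
        by_contra! hall
        rw [(Subgroup.eq_top_iff' _).2 hall, Subgroup.index_top] at hA
        exact hp.one_lt.ne hA
      obtain ⟨u, hu, hu1⟩ := exists_mul_eq_mul_pow hy hA hn x
      exact ⟨x, hx, u, hu, hu1, fun h2 => absurd h2 hp2⟩
  obtain ⟨z, hz⟩ := exists_isSplitPair_of_isOneUnit hy hA hn hexp hx hconj hu
  rcases hz.normalize hl hu with h1 | ⟨hne, w, hw⟩
  · exact Or.inl (h1.nonempty_mulEquiv_stemGroup hcard)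
  · exact Or.inr ⟨hne, hw.nonempty_mulEquiv_bushGroup hl hcard⟩

end Classification

/-! ### The groups of the tree -/

section Groups

variable {p l : ℕ} [Fact p.Prime]

theorem isGKType_stemGroup (p l : ℕ) [Fact p.Prime] :
    IsGKType p (StemGroup p (l + 1)) ∧
      Nonempty (gkKernel (StemGroup p (l + 1)) ≃* StemGroup p l) :=
  (isSplitPair_stemGroup p (l + 1)).isGKType isOneUnit_one (card_stemGroup p (l + 1))

theorem isGKType_bushGroup (hne : (p, l + 1) ≠ (2, 1)) (hl : 1 ≤ l + 1) :
    IsGKType p (BushGroup p (l + 1) hl) ∧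
      Nonempty (gkKernel (BushGroup p (l + 1) hl) ≃* StemGroup p l) :=
  (isSplitPair_bushGroup hl).isGKType (isOneUnit_one_add_pow hl hne) (card_bushGroup hl)

/-- The root `C_p × C_p` is the stem group on level `0`. -/
theorem nonempty_stemGroup_zero (p : ℕ) : Nonempty (StemGroup p 0 ≃* C p × C p) :=
  ⟨(MulEquiv.refl _).prodCongr
    (ZMod.ringEquivCongr (pow_one p)).toAddEquiv.toMultiplicative⟩

theorem card_root (p : ℕ) [Fact p.Prime] : Nat.card (C p × C p) = p ^ 2 := by
  rw [Nat.card_prod, card_C, sq]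

theorem exponent_root (p : ℕ) [Fact p.Prime] : Monoid.exponent (C p × C p) = p := by
  rw [Monoid.exponent_prod, Monoid.exponent_multiplicative, ZMod.exponent]
  exact Nat.lcm_self p

theorem not_isGKType_root (p : ℕ) [Fact p.Prime] : ¬ IsGKType p (C p × C p) :=
  not_isGKType_of_card_of_exponent_eq (card_root p) (exponent_root p)

theorem hasGKRoot_stemGroup (p l : ℕ) [Fact p.Prime] :
    HasGKRoot p (StemGroup p l) (C p × C p) l := by
  induction l with
  | zero =>
    obtain ⟨e⟩ := nonempty_stemGroup_zero p
    exact hasGKRoot_zero_iff.2 ⟨fun h => not_isGKType_root p (h.congr e), ⟨e⟩⟩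
  | succ l ih =>
    obtain ⟨h, ⟨e⟩⟩ := isGKType_stemGroup p l
    exact hasGKRoot_succ_iff.2 ⟨h, ih.congr e.symm (MulEquiv.refl _)⟩

theorem hasGKRoot_bushGroup (hl : 1 ≤ l) (hne : (p, l) ≠ (2, 1)) :
    HasGKRoot p (BushGroup p l hl) (C p × C p) l := by
  obtain ⟨l, rfl⟩ : ∃ k, l = k + 1 := ⟨l - 1, by omega⟩
  obtain ⟨h, ⟨e⟩⟩ := isGKType_bushGroup hne hl
  exact hasGKRoot_succ_iff.2 ⟨h, (hasGKRoot_stemGroup p l).congr e.symm (MulEquiv.refl _)⟩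

theorem IsSplitPair.rank_eq_two {u : ℕ} {G : Type*} [Group G] [Finite G] {x y : G}
    (h : IsSplitPair p l u y x) (hcard : Nat.card G = p ^ (l + 2))
    (hexp : Monoid.exponent G = p ^ (l + 1)) : Group.rank G = 2 := by
  classical
  have hp := (Fact.out : p.Prime)
  apply le_antisymm
  · have hcl : Subgroup.closure (({x, y} : Finset G) : Set G) = ⊤ := by
      rw [Subgroup.eq_top_iff']
      intro g
      obtain ⟨j, i, rfl⟩ := h.exists_pow_mul_pow hcard g
      exact mul_mem (Subgroup.pow_mem _ (Subgroup.subset_closure (by simp)) j)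
        (Subgroup.pow_mem _ (Subgroup.subset_closure (by simp)) i)
    exact (Group.rank_le hcl).trans Finset.card_le_two
  · by_contra hlt
    obtain ⟨S, hS, hcl⟩ := Group.rank_spec G
    obtain ⟨g, hg⟩ := Finset.card_le_one_iff_subset_singleton.1 (show S.card ≤ 1 by omega)
    have htop : Subgroup.zpowers g = ⊤ := by
      rw [← top_le_iff, ← hcl, Subgroup.zpowers_eq_closure]
      exact Subgroup.closure_mono (by exact_mod_cast hg)
    have h1 : Nat.card G = orderOf g := by
      rw [← Nat.card_zpowers, htop, Subgroup.card_top]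
    have h2 := Monoid.order_dvd_exponent g
    rw [← h1, hcard, hexp, Nat.pow_dvd_pow_iff_le_right hp.one_lt] at h2
    omega

theorem rank_stemGroup (p l : ℕ) [Fact p.Prime] : Group.rank (StemGroup p l) = 2 :=
  (isSplitPair_stemGroup p l).rank_eq_two (card_stemGroup p l)
    ((hasGKRoot_stemGroup p l).card_and_exponent (card_root p) (exponent_root p)).2

theorem rank_bushGroup (hl : 1 ≤ l) (hne : (p, l) ≠ (2, 1)) :
    Group.rank (BushGroup p l hl) = 2 :=
  (isSplitPair_bushGroup hl).rank_eq_two (card_bushGroup hl)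
    ((hasGKRoot_bushGroup hl hne).card_and_exponent (card_root p) (exponent_root p)).2

theorem cyclicDeficiency_eq_one_iff {G : Type*} [Group G] [Finite G]
    (hcard : Nat.card G = p ^ (l + 2)) :
    cyclicDeficiency p G = 1 ↔ Monoid.exponent G = p ^ (l + 1) := by
  have hp := (Fact.out : p.Prime)
  obtain ⟨k, -, hk⟩ := (Nat.dvd_prime_pow hp).1 (hcard ▸ Group.exponent_dvd_nat_card (G := G))
  rw [cyclicDeficiency, hcard, hk, Nat.log_pow hp.one_lt, Nat.log_pow hp.one_lt,
    Nat.pow_right_inj hp.two_le]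
  omega

/-! ### The maximal class `2`-groups -/

theorem not_isGKType_dihedralGroup (hl : 1 ≤ l) :
    ¬ IsGKType 2 (DihedralGroup (2 ^ (l + 1))) := by
  have : NeZero (2 ^ (l + 1)) := ⟨by positivity⟩
  have hexp : 2 ^ (l + 1) ≤ Monoid.exponent (DihedralGroup (2 ^ (l + 1))) :=
    Nat.le_of_dvd (Monoid.ExponentExists.of_finite.exponent_pos) (by
      have := Monoid.order_dvd_exponent (DihedralGroup.r 1 : DihedralGroup (2 ^ (l + 1)))
      rwa [DihedralGroup.orderOf_r_one] at this)
  have h2 : 2 ^ 2 ≤ 2 ^ (l + 1) := Nat.pow_le_pow_right (by norm_num) (by omega)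
  refine not_isGKType_of_closure_eq_top (s := Set.range DihedralGroup.sr) ?_ ?_
  · rintro _ ⟨i, rfl⟩
    rw [gkSet, Set.mem_ofPred_eq, DihedralGroup.orderOf_sr]
    omega
  · rw [Subgroup.eq_top_iff']
    rintro (i | i)
    · have := mul_mem (Subgroup.subset_closure (Set.mem_range_self (f := DihedralGroup.sr) 0))
        (Subgroup.subset_closure (Set.mem_range_self (f := DihedralGroup.sr) i))
      rwa [DihedralGroup.sr_mul_sr, sub_zero] at this
    · exact Subgroup.subset_closure (Set.mem_range_self i)

theorem not_isGKType_quaternionGroup (hl : 1 ≤ l) :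
    ¬ IsGKType 2 (QuaternionGroup (2 ^ l)) := by
  have : NeZero (2 ^ l) := ⟨by positivity⟩
  rcases Nat.lt_or_ge l 2 with hlt | hl2
  · -- in the quaternion group of order `8`, only `±1` have non-maximal order
    obtain rfl : l = 1 := by omega
    intro h
    have hexp : Monoid.exponent (QuaternionGroup (2 ^ 1)) = 4 := by
      rw [QuaternionGroup.exponent]
      rfl
    have hcard := h.card_eq
    rw [Nat.card_eq_fintype_card, QuaternionGroup.card] at hcard
    have hsub : (gkKernel (QuaternionGroup (2 ^ 1)) : Set (QuaternionGroup (2 ^ 1))) ⊆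
        {QuaternionGroup.a 0, QuaternionGroup.a 2} := by
      intro g hg
      rw [SetLike.mem_coe, h.mem_gkKernel, hexp] at hg
      rcases g with i | i
      · rw [QuaternionGroup.orderOf_a] at hg
        have key : ∀ v < 4, 4 / Nat.gcd 4 v < 4 → v = 0 ∨ v = 2 := by decide
        rw [← ZMod.natCast_zmod_val i]
        rcases key i.val (ZMod.val_lt i) hg with h0 | h0 <;> rw [h0]
        exacts [Or.inl (by rw [Nat.cast_zero]), Or.inr rfl]
      · rw [QuaternionGroup.orderOf_xa] at hg
        exact absurd hg (lt_irrefl _)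
    have h1 := Set.ncard_le_ncard hsub (Set.toFinite _)
    have h2 := Set.ncard_insert_le (QuaternionGroup.a 0 : QuaternionGroup (2 ^ 1))
      {QuaternionGroup.a 2}
    rw [Set.ncard_singleton] at h2
    have h3 : Nat.card (gkKernel (QuaternionGroup (2 ^ 1))) =
        (gkKernel (QuaternionGroup (2 ^ 1)) : Set (QuaternionGroup (2 ^ 1))).ncard := rfl
    omega
  · have hexp : 2 * 2 ^ l ≤ Monoid.exponent (QuaternionGroup (2 ^ l)) :=
      Nat.le_of_dvd (Monoid.ExponentExists.of_finite.exponent_pos) (by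
        have := Monoid.order_dvd_exponent (QuaternionGroup.a 1 : QuaternionGroup (2 ^ l))
        rwa [QuaternionGroup.orderOf_a_one] at this)
    have h2 : 2 ^ 2 ≤ 2 ^ l := Nat.pow_le_pow_right (by norm_num) hl2
    refine not_isGKType_of_closure_eq_top (s := Set.range QuaternionGroup.xa) ?_ ?_
    · rintro _ ⟨i, rfl⟩
      rw [gkSet, Set.mem_ofPred_eq, QuaternionGroup.orderOf_xa]
      omega
    · rw [Subgroup.eq_top_iff']
      rintro (i | i)
      · have := mul_mem
          (Subgroup.subset_closure (Set.mem_range_self (f := QuaternionGroup.xa (n := 2 ^ l)) 0))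
          (Subgroup.subset_closure (Set.mem_range_self (f := QuaternionGroup.xa)
            (i - ((2 ^ l : ℕ) : ZMod _))))
        rwa [QuaternionGroup.xa_mul_xa, sub_zero, add_sub_cancel] at this
      · exact Subgroup.subset_closure (Set.mem_range_self i)

/-- If `y ^ x = y ^ (2 ^ l - 1)`, then `(x * y) ^ 2 = y ^ 2 ^ l` has order `2`, so that `x` and
`x * y` have non-maximal order. -/
theorem not_isGKType_of_semidihedral_relations {G : Type*} [Group G] [Finite G] {x y : G}
    (hl : 2 ≤ l) (hy : orderOf y = 2 ^ (l + 1)) (hx : x ^ 2 = 1)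
    (hconj : y * x = x * y ^ (2 ^ l - 1)) (htop : Subgroup.closure {x, y} = ⊤) :
    ¬ IsGKType 2 G := by
  have h8 : 2 ^ 3 ≤ 2 ^ (l + 1) := Nat.pow_le_pow_right (by norm_num) (by omega)
  have hexp : 2 ^ (l + 1) ≤ Monoid.exponent G :=
    Nat.le_of_dvd (Monoid.ExponentExists.of_finite.exponent_pos)
      (hy ▸ Monoid.order_dvd_exponent y)
  have hxy : (x * y) ^ 4 = 1 := by
    have h1 := mul_pow_eq hconj 1 2
    rw [pow_one, hx, one_mul, one_mul, Finset.sum_range_succ, Finset.sum_range_one, pow_zero,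
      pow_one, Nat.add_sub_cancel' Nat.one_le_two_pow] at h1
    rw [show 4 = 2 * 2 from rfl, pow_mul, h1, ← pow_mul, ← pow_succ, ← hy, pow_orderOf_eq_one]
  refine not_isGKType_of_closure_eq_top (s := {x, x * y}) ?_ ?_
  · have hxo := Nat.le_of_dvd (by norm_num) (orderOf_dvd_of_pow_eq_one hx)
    have hxyo := Nat.le_of_dvd (by norm_num) (orderOf_dvd_of_pow_eq_one hxy)
    rintro g (rfl | rfl) <;> rw [gkSet, Set.mem_ofPred_eq] <;> omega
  · have hxm : x ∈ Subgroup.closure {x, x * y} := Subgroup.subset_closure (by simp)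
    have hym : y ∈ Subgroup.closure {x, x * y} :=
      (Subgroup.mul_mem_cancel_left _ hxm).1 (Subgroup.subset_closure (by simp))
    rw [← top_le_iff, ← htop, Subgroup.closure_le]
    rintro g (rfl | rfl)
    exacts [hxm, hym]

theorem CyclicSplit.closure_eq_top (n m : ℕ) (U : (ZMod n)ˣ) (hU : U ^ m = 1) :
    Subgroup.closure {(SemidirectProduct.inr (Multiplicative.ofAdd 1) : CyclicSplit n m U hU),
      SemidirectProduct.inl (Multiplicative.ofAdd 1)} = ⊤ := by
  rw [Subgroup.eq_top_iff']
  intro g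
  rw [← SemidirectProduct.inl_left_mul_inr_right g]
  obtain ⟨i, hi⟩ := mem_zpowers_ofAdd_one _ g.left
  obtain ⟨j, hj⟩ := mem_zpowers_ofAdd_one _ g.right
  rw [← hi, ← hj]
  simp only [map_zpow]
  exact mul_mem (Subgroup.zpow_mem _ (Subgroup.subset_closure (by simp)) i)
    (Subgroup.zpow_mem _ (Subgroup.subset_closure (by simp)) j)

theorem not_isGKType_semidihedralGroup (hl : 2 ≤ l) : ¬ IsGKType 2 (SemidihedralGroup l hl) := by
  refine not_isGKType_of_semidihedral_relations
    (x := SemidirectProduct.inr (Multiplicative.ofAdd 1))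
    (y := SemidirectProduct.inl (Multiplicative.ofAdd 1)) hl ?_ ?_ ?_
    (CyclicSplit.closure_eq_top ..)
  · rw [orderOf_injective _ SemidirectProduct.inl_injective, orderOf_ofAdd_one]
  · rw [← map_pow, orderOf_dvd_iff_pow_eq_one.1 (orderOf_ofAdd_one 2).dvd, map_one]
  · have h := CyclicSplit.conj (2 ^ (l + 1)) 2
      (Units.ofPowEqOne _ 2 (sdUnit_pow l (by omega)) two_ne_zero)
      (Units.pow_ofPowEqOne _ _) 1
    rw [mul_assoc, inv_mul_eq_iff_eq_mul] at h
    rw [h, ← map_pow]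
    congr 2
    apply Multiplicative.toAdd.injective
    have hval : ((Units.ofPowEqOne _ 2 (sdUnit_pow l (by omega)) two_ne_zero :
      (ZMod (2 ^ (l + 1)))ˣ) : ZMod (2 ^ (l + 1))) = -1 + 2 ^ l := rfl
    rw [hval]
    simp [Nat.cast_sub (Nat.one_le_two_pow), sub_eq_neg_add]

end Groups

/-! ### The combinatorial model of the tree -/

section Tree

variable {p : ℕ}

/-- The positions in the tree of `C_p × C_p`: the pair `(l, false)` stands for the stem group on
level `l`, and `(l, true)` for the bush group on level `l`, where it exists. -/
def Node (p : ℕ) : Type := {x : ℕ × Bool // x.2 = true → 1 ≤ x.1 ∧ (p, x.1) ≠ (2, 1)}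

/-- The level of a position. -/
def Node.level (a : Node p) : ℕ := a.1.1

/-- The position of the stem group on level `l`. -/
def Node.stem (p l : ℕ) : Node p := ⟨(l, false), by simp⟩

/-- The position of the bush group on level `l`. -/
def Node.bush (l : ℕ) (hl : 1 ≤ l) (hne : (p, l) ≠ (2, 1)) : Node p :=
  ⟨(l, true), fun _ => ⟨hl, hne⟩⟩

theorem Node.ext_iff (a b : Node p) : a = b ↔ a.1 = b.1 := Subtype.ext_iff

theorem Node.eq_stem_or_eq_bush (a : Node p) :
    a = Node.stem p a.level ∨ ∃ hl hne, a = Node.bush a.level hl hne := by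
  obtain ⟨⟨l, _ | _⟩, h⟩ := a
  exacts [Or.inl rfl, Or.inr ⟨(h rfl).1, (h rfl).2, rfl⟩]

/-- Edges join a position to the stem position one level below. -/
def Node.Adj (a b : Node p) : Prop := a.level = b.level + 1 ∧ b.1.2 = false

/-- The isomorphism type of the group at a position. -/
noncomputable def Node.type [Fact p.Prime] : Node p → IsoType
  | ⟨(l, false), _⟩ => isoType (StemGroup p l)
  | ⟨(l, true), h⟩ => isoType (BushGroup p l (h rfl).1)

variable [Fact p.Prime]

theorem Node.type_stem (l : ℕ) : (Node.stem p l).type = isoType (StemGroup p l) := rfl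

theorem Node.type_bush (l : ℕ) (hl : 1 ≤ l) (hne : (p, l) ≠ (2, 1)) :
    (Node.bush l hl hne).type = isoType (BushGroup p l hl) := rfl

theorem exists_isoType_eq (τ : IsoType) : ∃ G : FiniteGrp.{0}, τ = isoType G := by
  induction τ using Quotient.inductionOn with
  | h G => exact ⟨G, rfl⟩

section

variable {G : Type} [Group G] [Finite G]

theorem Node.hasGKRoot {a : Node p} (h : a.type = isoType G) :
    HasGKRoot p G (C p × C p) a.level := by
  rcases a with ⟨⟨l, _ | _⟩, ha⟩
  · obtain ⟨e⟩ := (isoType_eq_iff _ _).1 h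
    exact (hasGKRoot_stemGroup p l).congr e (MulEquiv.refl _)
  · obtain ⟨e⟩ := (isoType_eq_iff _ _).1 h
    exact (hasGKRoot_bushGroup (ha rfl).1 (ha rfl).2).congr e (MulEquiv.refl _)

theorem Node.isGKType_iff {a : Node p} (h : a.type = isoType G) :
    IsGKType p G ↔ a.level ≠ 0 := by
  have h1 := Node.hasGKRoot h
  rcases hl : a.level with _ | l
  · rw [hl] at h1
    simpa using (hasGKRoot_zero_iff.1 h1).1
  · rw [hl] at h1
    simpa using (hasGKRoot_succ_iff.1 h1).1

theorem Node.isoType_gkKernel {a : Node p} {l : ℕ} (h : a.type = isoType G)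
    (hl : a.level = l + 1) : isoType (gkKernel G) = (Node.stem p l).type := by
  rw [Node.type_stem, isoType_eq_iff]
  rcases a with ⟨⟨l, _ | _⟩, ha⟩
  · obtain rfl : l = _ + 1 := hl
    obtain ⟨e⟩ := (isoType_eq_iff _ _).1 h
    exact ⟨(gkKernelCongr e.symm).trans (isGKType_stemGroup p _).2.some⟩
  · obtain rfl : l = _ + 1 := hl
    obtain ⟨e⟩ := (isoType_eq_iff _ _).1 h
    exact ⟨(gkKernelCongr e.symm).trans (isGKType_bushGroup (ha rfl).2 (ha rfl).1).2.some⟩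

theorem Node.commutative_iff {a : Node p} (h : a.type = isoType G) :
    (∀ g k : G, g * k = k * g) ↔ a.1.2 = false := by
  rcases a with ⟨⟨l, _ | _⟩, ha⟩
  · obtain ⟨e⟩ := (isoType_eq_iff _ _).1 h
    refine iff_of_true (fun g k => ?_) rfl
    rw [← e.symm.injective.eq_iff, map_mul, map_mul, mul_comm]
  · obtain ⟨e⟩ := (isoType_eq_iff _ _).1 h
    refine iff_of_false (fun hcomm => (isSplitPair_bushGroup (p := p) (ha rfl).1).not_commutative
      fun g k => ?_) (by simp)
    rw [← e.injective.eq_iff, map_mul, map_mul, hcomm]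

theorem Node.rank_eq_two {a : Node p} (h : a.type = isoType G) : Group.rank G = 2 := by
  rcases a with ⟨⟨l, _ | _⟩, ha⟩
  · obtain ⟨e⟩ := (isoType_eq_iff _ _).1 h
    rw [← Group.rank_congr e, rank_stemGroup]
  · obtain ⟨e⟩ := (isoType_eq_iff _ _).1 h
    rw [← Group.rank_congr e, rank_bushGroup _ (ha rfl).2]

/-- Every group with GK root `C_p × C_p` occurs at some position: order and exponent are
determined by the level, and the classification applies. -/
theorem exists_node_type_eq {l : ℕ} (h : HasGKRoot p G (C p × C p) l) :
    ∃ a : Node p, a.type = isoType G := by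
  rcases l with _ | l
  · obtain ⟨-, ⟨e⟩⟩ := hasGKRoot_zero_iff.1 h
    obtain ⟨f⟩ := nonempty_stemGroup_zero p
    exact ⟨Node.stem p 0, (isoType_eq_iff _ _).2 ⟨f.trans e.symm⟩⟩
  · obtain ⟨hcard, hexp⟩ := h.card_and_exponent (card_root p) (exponent_root p)
    rcases nonempty_mulEquiv_of_card_of_exponent (Nat.succ_pos l) hcard hexp
      (fun _ => (hasGKRoot_succ_iff.1 h).1) with ⟨⟨e⟩⟩ | ⟨hne, ⟨e⟩⟩
    · exact ⟨Node.stem p (l + 1), (isoType_eq_iff _ _).2 ⟨e.symm⟩⟩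
    · exact ⟨Node.bush (l + 1) (Nat.succ_pos l) hne, (isoType_eq_iff _ _).2 ⟨e.symm⟩⟩

end

theorem Node.type_injective : Function.Injective (Node.type (p := p)) := by
  intro a b hab
  obtain ⟨G, hG⟩ := exists_isoType_eq b.type
  have h1 : a.1.1 = b.1.1 := (Node.hasGKRoot (hab.trans hG)).level_unique (Node.hasGKRoot hG)
  have h2 : a.1.2 = false ↔ b.1.2 = false :=
    (Node.commutative_iff (hab.trans hG)).symm.trans (Node.commutative_iff hG)
  refine Subtype.ext (Prod.ext h1 ?_)
  cases ha : a.1.2 <;> cases hb : b.1.2 <;> simp_all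

/-- The vertex of the GK tree at a position. -/
noncomputable def Node.toVertex (a : Node p) : GKVertex p (C p × C p) :=
  ⟨a.type, by
    obtain ⟨G, hG⟩ := exists_isoType_eq a.type
    have h := Node.hasGKRoot hG
    by_cases h0 : a.level = 0
    · rw [h0] at h
      obtain ⟨-, e⟩ := hasGKRoot_zero_iff.1 h
      exact Or.inl (hG.trans ((isoType_eq_iff _ _).2 e))
    · exact Or.inr ⟨G, hG, (Node.isGKType_iff hG).2 h0, _, h⟩⟩

/-- The positions are in bijection with the vertices of the GK tree. -/
noncomputable def nodeEquiv (p : ℕ) [Fact p.Prime] : Node p ≃ GKVertex p (C p × C p) :=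
  Equiv.ofBijective Node.toVertex
    ⟨fun _ _ h => Node.type_injective (congrArg Subtype.val h), fun v => by
      obtain ⟨a, ha⟩ : ∃ a : Node p, a.type = v.1 := by
        rcases v.2 with h | ⟨G, hG, -, l, hl⟩
        · obtain ⟨f⟩ := nonempty_stemGroup_zero p
          exact ⟨Node.stem p 0, ((isoType_eq_iff _ _).2 ⟨f⟩).trans h.symm⟩
        · obtain ⟨a, ha⟩ := exists_node_type_eq hl
          exact ⟨a, ha.trans hG.symm⟩
      exact ⟨a, Subtype.ext ha⟩⟩

theorem nodeEquiv_val (a : Node p) : (nodeEquiv p a).1 = a.type := rfl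

theorem nodeEquiv_stem_zero : nodeEquiv p (Node.stem p 0) = gkTreeRoot p (C p × C p) :=
  Subtype.ext ((isoType_eq_iff _ _).2 (nonempty_stemGroup_zero p))

theorem adj_nodeEquiv_iff (a b : Node p) :
    (gkTree p (C p × C p)).Adj (nodeEquiv p a) (nodeEquiv p b) ↔ a.Adj b := by
  constructor
  · rintro ⟨G, hG, hGK, hb⟩
    have h0 := (Node.isGKType_iff hG).1 hGK
    obtain ⟨l, hl⟩ : ∃ l, a.level = l + 1 := ⟨a.level - 1, by omega⟩
    obtain rfl : b = Node.stem p l :=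
      Node.type_injective (hb.trans (Node.isoType_gkKernel hG hl))
    exact ⟨hl, rfl⟩
  · rintro ⟨h1, h2⟩
    obtain ⟨G, hG⟩ := exists_isoType_eq a.type
    refine ⟨G, hG, (Node.isGKType_iff hG).2 (by omega), ?_⟩
    rw [Node.isoType_gkKernel hG h1, nodeEquiv_val]
    congr 1
    exact Subtype.ext (Prod.ext rfl h2)

theorem hasLevel_nodeEquiv_iff (a : Node p) (l : ℕ) :
    HasLevel p (C p × C p) (nodeEquiv p a) l ↔ a.level = l := by
  constructor
  · rintro ⟨G, hG, h⟩
    exact (Node.hasGKRoot hG).level_unique h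
  · rintro rfl
    obtain ⟨G, hG⟩ := exists_isoType_eq a.type
    exact ⟨G, hG, Node.hasGKRoot hG⟩

/-! ### Stem and bushes -/

theorem isStem_iff (H : ℕ → GKVertex p (C p × C p)) :
    IsStem (gkTree p (C p × C p)) (gkTreeRoot p (C p × C p)) H ↔
      H = fun l => nodeEquiv p (Node.stem p l) := by
  constructor
  · rintro ⟨h0, h⟩
    obtain ⟨f, rfl⟩ : ∃ f : ℕ → Node p, H = fun l => nodeEquiv p (f l) :=
      ⟨fun l => (nodeEquiv p).symm (H l), by simp⟩
    simp only [adj_nodeEquiv_iff] at h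
    funext l
    have hstem : f l = Node.stem p (f l).level := Subtype.ext (Prod.ext rfl (h l).2)
    have hlevel : (f l).level = l := by
      clear hstem
      induction l with
      | zero => rw [(nodeEquiv p).injective (h0.trans nodeEquiv_stem_zero.symm)]; rfl
      | succ l ih => rw [(h l).1, ih]
    rw [hstem, hlevel]
  · rintro rfl
    exact ⟨nodeEquiv_stem_zero, fun n => (adj_nodeEquiv_iff _ _).2 ⟨rfl, rfl⟩⟩

theorem onStem_nodeEquiv_iff (a : Node p) :
    OnStem (gkTree p (C p × C p)) (gkTreeRoot p (C p × C p)) (nodeEquiv p a) ↔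
      a.1.2 = false := by
  simp only [OnStem, isStem_iff, exists_eq_left, (nodeEquiv p).injective.eq_iff]
  constructor
  · rintro ⟨l, rfl⟩
    rfl
  · intro h
    exact ⟨a.level, Subtype.ext (Prod.ext rfl h.symm)⟩

/-- A bush position is joined directly to the stem, so it has depth `1`. -/
theorem branchesAt_nodeEquiv_iff {a b : Node p} {t : ℕ} (ha : a.1.2 = true) :
    BranchesAt (gkTree p (C p × C p)) (gkTreeRoot p (C p × C p)) (nodeEquiv p a)
      (nodeEquiv p b) t ↔ t = 1 ∧ a.Adj b := by
  have hna : ¬ OnStem (gkTree p (C p × C p)) (gkTreeRoot p (C p × C p)) (nodeEquiv p a) := by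
    simp [onStem_nodeEquiv_iff, ha]
  constructor
  · rintro ⟨f, h0, ht, hadj, hns, hs⟩
    have ht0 : t ≠ 0 := by
      rintro rfl
      exact hna (h0 ▸ ht ▸ hs)
    obtain ⟨c, hc⟩ := (nodeEquiv p).surjective (f 1)
    have hac : a.Adj c := by
      rw [← adj_nodeEquiv_iff, hc, ← h0]
      exact hadj 0 (by omega)
    have ht1 : t = 1 := by
      by_contra hne
      exact hns 1 (by omega) (hc ▸ (onStem_nodeEquiv_iff c).2 hac.2)
    subst ht1
    rw [(nodeEquiv p).injective (hc.trans ht)] at hac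
    exact ⟨rfl, hac⟩
  · rintro ⟨rfl, h⟩
    refine ⟨fun n => if n = 0 then nodeEquiv p a else nodeEquiv p b, rfl, rfl, ?_, ?_, ?_⟩
    · intro i hi
      obtain rfl : i = 0 := by omega
      exact (adj_nodeEquiv_iff a b).2 h
    · intro i hi
      obtain rfl : i = 0 := by omega
      exact hna
    · exact (onStem_nodeEquiv_iff b).2 h.2

theorem mem_bush_nodeEquiv_iff (a : Node p) (s : ℕ) :
    nodeEquiv p a ∈ bush (gkTree p (C p × C p)) (gkTreeRoot p (C p × C p))
      (nodeEquiv p (Node.stem p s)) ↔ a.1 = (s, false) ∨ a.1 = (s + 1, true) := by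
  change (_ ∨ _) ↔ _
  rw [(nodeEquiv p).injective.eq_iff]
  cases ha : a.1.2
  · have : a.1 ≠ (s + 1, true) := fun h => by simp [h] at ha
    constructor
    · rintro (rfl | ⟨t, f, h0, ht, -, hns, -⟩)
      · exact Or.inl rfl
      · have ht0 : t = 0 := by
          by_contra hne
          exact hns 0 (by omega) (h0 ▸ (onStem_nodeEquiv_iff a).2 ha)
        subst ht0
        rw [(nodeEquiv p).injective (h0.symm.trans ht)]
        exact Or.inl rfl
    · exact fun h => Or.inl (Subtype.ext (h.resolve_right this))
  · have h1 : a.1 ≠ (s, false) := fun h => by simp [h] at ha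
    have h2 : a ≠ Node.stem p s := fun h => h1 (congrArg Subtype.val h)
    simp only [branchesAt_nodeEquiv_iff ha, exists_eq_left, h1, h2, false_or]
    exact ⟨fun h => Prod.ext h.1 ha, fun h => ⟨congrArg Prod.fst h, rfl⟩⟩

/-- An isomorphism of induced subgraphs of the models gives one of the GK trees. -/
noncomputable def subrelIso {q : ℕ} [Fact q.Prime] {P : GKVertex p (C p × C p) → Prop}
    {Q : GKVertex q (C q × C q) → Prop}
    (e : {a : Node p // P (nodeEquiv p a)} ≃ {b : Node q // Q (nodeEquiv q b)})
    (he : ∀ a b, (e a).1.Adj (e b).1 ↔ a.1.Adj b.1) :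
    Subrel (gkTree p (C p × C p)).Adj P ≃r Subrel (gkTree q (C q × C q)).Adj Q where
  toEquiv := (((nodeEquiv p).subtypeEquiv fun _ => Iff.rfl).symm.trans e).trans
    ((nodeEquiv q).subtypeEquiv fun _ => Iff.rfl)
  map_rel_iff' := by
    intro v w
    obtain ⟨a, rfl⟩ := ((nodeEquiv p).subtypeEquiv (p := fun a => P (nodeEquiv p a)) (q := P)
      fun _ => Iff.rfl).surjective v
    obtain ⟨b, rfl⟩ := ((nodeEquiv p).subtypeEquiv (p := fun a => P (nodeEquiv p a)) (q := P)
      fun _ => Iff.rfl).surjective w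
    simp only [Equiv.trans_apply, Equiv.symm_apply_apply]
    exact (adj_nodeEquiv_iff _ _).trans ((he a b).trans (adj_nodeEquiv_iff _ _).symm)

/-- Shifting positions by one level maps the bush at `H_s` to the bush at `H_{s+1}`. -/
def shiftEquiv (p s : ℕ) (hs : (p, s + 1) ≠ (2, 1)) :
    {a : Node p // a.1 = (s, false) ∨ a.1 = (s + 1, true)} ≃
      {a : Node p // a.1 = (s + 1, false) ∨ a.1 = (s + 1 + 1, true)} where
  toFun a := ⟨⟨(a.1.1.1 + 1, a.1.1.2), by
      rcases a.2 with h | h <;> simp [h]⟩, by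
      rcases a.2 with h | h <;> simp [h]⟩
  invFun a := ⟨⟨(a.1.1.1 - 1, a.1.1.2), by
      rcases a.2 with h | h <;> simp only [h]
      · simp
      · exact fun _ => ⟨by omega, hs⟩⟩, by
      rcases a.2 with h | h <;> simp [h]⟩
  left_inv a := by
    refine Subtype.ext (Subtype.ext ?_)
    simp
  right_inv a := by
    refine Subtype.ext (Subtype.ext ?_)
    rcases a.2 with h | h <;> simp [h]

theorem existsUnique_isStem (p : ℕ) [Fact p.Prime] :
    ∃! H, IsStem (gkTree p (C p × C p)) (gkTreeRoot p (C p × C p)) H := by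
  simp only [isStem_iff, existsUnique_eq]

theorem isPeriodicFrom (k : ℕ) (hk : ∀ s, k ≤ s → (p, s + 1) ≠ (2, 1)) :
    IsPeriodicFrom (gkTree p (C p × C p)) (gkTreeRoot p (C p × C p)) 1 k := by
  refine ⟨existsUnique_isStem p, fun H hH s hs => ?_⟩
  rw [isStem_iff] at hH
  subst hH
  refine ⟨subrelIso (((Equiv.subtypeEquivRight fun a => mem_bush_nodeEquiv_iff a s).trans
    (shiftEquiv p s (hk s hs))).trans
    (Equiv.subtypeEquivRight fun a => mem_bush_nodeEquiv_iff a (s + 1)).symm) fun a b => ?_⟩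
  exact and_congr (Nat.add_right_cancel_iff (n := 1)) Iff.rfl

/-- From level `2` on, the positions do not depend on the prime. -/
def levelEquiv (p q : ℕ) :
    {a : Node p // 2 ≤ a.level} ≃ {a : Node q // 2 ≤ a.level} where
  toFun a := ⟨⟨a.1.1, fun h => ⟨(a.1.2 h).1, fun h' => by
    have h1 := a.2
    have h2 := congrArg Prod.snd h'
    simp only [Node.level] at h1 h2
    omega⟩⟩, a.2⟩
  invFun a := ⟨⟨a.1.1, fun h => ⟨(a.1.2 h).1, fun h' => by
    have h1 := a.2
    have h2 := congrArg Prod.snd h'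
    simp only [Node.level] at h1 h2
    omega⟩⟩, a.2⟩
  left_inv _ := rfl
  right_inv _ := rfl

theorem exists_hasLevel_nodeEquiv_iff (a : Node p) :
    (∃ l ≥ 2, HasLevel p (C p × C p) (nodeEquiv p a) l) ↔ 2 ≤ a.level := by
  simp only [hasLevel_nodeEquiv_iff]
  exact ⟨fun ⟨l, h, h'⟩ => h' ▸ h, fun h => ⟨_, h, rfl⟩⟩

theorem exists_levelIso (p q : ℕ) [Fact p.Prime] [Fact q.Prime] :
    ∃ e : Subrel (gkTree p (C p × C p)).Adj (fun v => ∃ l ≥ 2, HasLevel p (C p × C p) v l) ≃r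
        Subrel (gkTree q (C q × C q)).Adj (fun v => ∃ l ≥ 2, HasLevel q (C q × C q) v l),
      ∀ v l, HasLevel p (C p × C p) v.1 l ↔ HasLevel q (C q × C q) (e v).1 l := by
  let e := ((Equiv.subtypeEquivRight fun a : Node p => exists_hasLevel_nodeEquiv_iff a).trans
    (levelEquiv p q)).trans
    (Equiv.subtypeEquivRight fun a : Node q => exists_hasLevel_nodeEquiv_iff a).symm
  refine ⟨subrelIso e fun a b => Iff.rfl, ?_⟩
  rintro ⟨v, hv⟩ l
  obtain ⟨a, rfl⟩ := (nodeEquiv p).surjective v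
  have h1 : ((subrelIso e fun a b => Iff.rfl : Subrel (gkTree p (C p × C p)).Adj
      (fun v => ∃ l ≥ 2, HasLevel p (C p × C p) v l) ≃r
      Subrel (gkTree q (C q × C q)).Adj (fun v => ∃ l ≥ 2, HasLevel q (C q × C q) v l))
      ⟨nodeEquiv p a, hv⟩).1 = nodeEquiv q (e ⟨a, hv⟩).1 := by
    change nodeEquiv q (e ⟨(nodeEquiv p).symm (nodeEquiv p a), _⟩).1 = _
    simp only [Equiv.symm_apply_apply]
  rw [h1, hasLevel_nodeEquiv_iff, hasLevel_nodeEquiv_iff]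
  rfl

end Tree

end GK

theorem mainTheorem9 (p : ℕ) [Fact p.Prime] :
    -- the root is not of GK type
    (¬ IsGKType p (C p × C p)) ∧
    -- the stem: it is unique, and on level `l` it is occupied by `C_p × C_{p^{l+1}}`
    (∃! H : ℕ → GKVertex p (C p × C p),
      IsStem (gkTree p (C p × C p)) (gkTreeRoot p (C p × C p)) H) ∧
    (∀ H : ℕ → GKVertex p (C p × C p),
      IsStem (gkTree p (C p × C p)) (gkTreeRoot p (C p × C p)) H →
      ∀ l, (H l).1 = isoType (StemGroup p l) ∧ HasLevel p (C p × C p) (H l) l) ∧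
    -- the groups `G_l = C_{p^{l+1}} ⋊ C_p`, for `l ≥ 1` and `(p, l) ≠ (2, 1)`
    (∀ (l : ℕ) (hl : 1 ≤ l), (p, l) ≠ (2, 1) →
      Nat.card (BushGroup p l hl) = p ^ (l + 2) ∧
      (¬ ∀ a b : BushGroup p l hl, a * b = b * a) ∧
      cyclicDeficiency p (BushGroup p l hl) = 1 ∧
      IsGKType p (BushGroup p l hl) ∧
      Nonempty (gkKernel (BushGroup p l hl) ≃* C p × C (p ^ l)) ∧
      HasGKRoot p (BushGroup p l hl) (C p × C p) l) ∧
    -- the whole tree: its vertices ...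
    (∀ τ : IsoType,
      (∃ v : GKVertex p (C p × C p), v.1 = τ) ↔
        (∃ l, τ = isoType (StemGroup p l)) ∨
        (∃ (l : ℕ) (hl : 1 ≤ l), (p, l) ≠ (2, 1) ∧ τ = isoType (BushGroup p l hl))) ∧
    -- ... and its edges
    (∀ v w : GKVertex p (C p × C p), (gkTree p (C p × C p)).Adj v w ↔
      ∃ (l : ℕ) (hl : 1 ≤ l), w.1 = isoType (StemGroup p (l - 1)) ∧
        (v.1 = isoType (StemGroup p l) ∨
          ((p, l) ≠ (2, 1) ∧ v.1 = isoType (BushGroup p l hl)))) ∧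
    -- the vertices lying on the stem are the abelian groups
    (∀ (v : GKVertex p (C p × C p)) (G : FiniteGrp.{0}), v.1 = isoType G →
      (OnStem (gkTree p (C p × C p)) (gkTreeRoot p (C p × C p)) v ↔
        ∀ a b : G, a * b = b * a)) ∧
    -- the bushes: precisely one further vertex, namely `G_l`, branches off at level `l - 1`,
    -- unless `(p, l) = (2, 1)`
    (∀ H : ℕ → GKVertex p (C p × C p),
      IsStem (gkTree p (C p × C p)) (gkTreeRoot p (C p × C p)) H →
      (∀ (l : ℕ) (hl : 1 ≤ l), (p, l) ≠ (2, 1) →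
        ∃ v : GKVertex p (C p × C p), v.1 = isoType (BushGroup p l hl) ∧
          HasLevel p (C p × C p) v l ∧
          BranchesAt (gkTree p (C p × C p)) (gkTreeRoot p (C p × C p)) v (H (l - 1)) 1 ∧
          bush (gkTree p (C p × C p)) (gkTreeRoot p (C p × C p)) (H (l - 1)) = {H (l - 1), v}) ∧
      (p = 2 →
        bush (gkTree p (C p × C p)) (gkTreeRoot p (C p × C p)) (H 0) = {H 0} ∧
        ∀ v : GKVertex p (C p × C p), HasLevel p (C p × C p) v 1 ↔ v = H 1)) ∧
    -- periodicity
    (p ≠ 2 → IsPeriodicFrom (gkTree p (C p × C p)) (gkTreeRoot p (C p × C p)) 1 0) ∧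
    (p = 2 → IsPeriodicFrom (gkTree p (C p × C p)) (gkTreeRoot p (C p × C p)) 1 1) ∧
    -- for odd `p`, the tree coincides on the levels `l ≥ 2` with the tree rooted at `C_2 × C_2`
    (p ≠ 2 →
      ∃ e : Subrel (gkTree 2 (C 2 × C 2)).Adj (fun v => ∃ l ≥ 2, HasLevel 2 (C 2 × C 2) v l) ≃r
          Subrel (gkTree p (C p × C p)).Adj (fun v => ∃ l ≥ 2, HasLevel p (C p × C p) v l),
        ∀ v l, HasLevel 2 (C 2 × C 2) v.1 l ↔ HasLevel p (C p × C p) (e v).1 l) ∧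
    -- all groups in the tree have rank two
    (∀ (v : GKVertex p (C p × C p)) (G : FiniteGrp.{0}), v.1 = isoType G → Group.rank G = 2) ∧
    -- the non-abelian groups of GK type of cyclic deficiency one
    (∀ (l : ℕ) (hl : 1 ≤ l) (G : FiniteGrp.{0}), Nat.card G = p ^ (l + 2) →
      cyclicDeficiency p G = 1 → (¬ ∀ a b : G, a * b = b * a) →
      (IsGKType p G ↔ (p, l) ≠ (2, 1) ∧ Nonempty (G ≃* BushGroup p l hl)) ∧
      (p ≠ 2 → Nonempty (G ≃* BushGroup p l hl) ∧ IsGKType p G)) ∧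
    -- the remaining 2-groups of maximal class are not of GK type
    (∀ l : ℕ, 1 ≤ l → ¬ IsGKType 2 (DihedralGroup (2 ^ (l + 1)))) ∧
    (∀ (l : ℕ) (hl : 2 ≤ l), ¬ IsGKType 2 (SemidihedralGroup l hl)) ∧
    (∀ l : ℕ, 1 ≤ l → ¬ IsGKType 2 (QuaternionGroup (2 ^ l))) := by
  refine ⟨not_isGKType_root p, existsUnique_isStem p, ?_, ?_, ?_, ?_, ?_, ?_, ?_, ?_, ?_, ?_, ?_,
    fun l hl => not_isGKType_dihedralGroup hl, fun l hl => not_isGKType_semidihedralGroup hl,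
    fun l hl => not_isGKType_quaternionGroup hl⟩
  · intro H hH l
    rw [isStem_iff] at hH
    subst hH
    exact ⟨rfl, (hasLevel_nodeEquiv_iff _ _).2 rfl⟩
  · intro l hl hne
    have hroot := hasGKRoot_bushGroup hl hne
    refine ⟨card_bushGroup hl, (isSplitPair_bushGroup hl).not_commutative,
      (cyclicDeficiency_eq_one_iff (card_bushGroup hl)).2
        (hroot.card_and_exponent (card_root p) (exponent_root p)).2, ?_, ?_, hroot⟩
    · exact (Node.isGKType_iff (Node.type_bush l hl hne)).2 (Nat.one_le_iff_ne_zero.1 hl)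
    · obtain ⟨k, rfl⟩ : ∃ k, l = k + 1 := ⟨l - 1, by omega⟩
      exact (isGKType_bushGroup hne hl).2
  · intro τ
    constructor
    · rintro ⟨v, rfl⟩
      obtain ⟨a, rfl⟩ := (nodeEquiv p).surjective v
      rcases a.eq_stem_or_eq_bush with h | ⟨hl, hne, h⟩
      · exact Or.inl ⟨a.level, congrArg Node.type h⟩
      · exact Or.inr ⟨a.level, hl, hne, congrArg Node.type h⟩
    · rintro (⟨l, rfl⟩ | ⟨l, hl, hne, rfl⟩)
      · exact ⟨nodeEquiv p (Node.stem p l), rfl⟩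
      · exact ⟨nodeEquiv p (Node.bush l hl hne), rfl⟩
  · intro v w
    obtain ⟨a, rfl⟩ := (nodeEquiv p).surjective v
    obtain ⟨b, rfl⟩ := (nodeEquiv p).surjective w
    rw [adj_nodeEquiv_iff]
    simp only [nodeEquiv_val]
    constructor
    · rintro ⟨h1, h2⟩
      refine ⟨a.level, by omega, ?_, ?_⟩
      · rw [h1, Nat.add_sub_cancel]
        exact congrArg Node.type (Subtype.ext (Prod.ext rfl h2) : b = Node.stem p b.level)
      · rcases a.eq_stem_or_eq_bush with h | ⟨hl, hne, h⟩
        · exact Or.inl (congrArg Node.type h)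
        · exact Or.inr ⟨hne, congrArg Node.type h⟩
    · rintro ⟨l, hl, hb, ha⟩
      obtain rfl : b = Node.stem p (l - 1) := Node.type_injective hb
      rcases ha with ha | ⟨hne, ha⟩
      · obtain rfl : a = Node.stem p l := Node.type_injective ha
        exact ⟨(Nat.sub_add_cancel hl).symm, rfl⟩
      · obtain rfl : a = Node.bush l hl hne := Node.type_injective ha
        exact ⟨(Nat.sub_add_cancel hl).symm, rfl⟩
  · intro v G hG
    obtain ⟨a, rfl⟩ := (nodeEquiv p).surjective v
    rw [onStem_nodeEquiv_iff, Node.commutative_iff hG]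
  · intro H hH
    rw [isStem_iff] at hH
    subst hH
    constructor
    · intro l hl hne
      obtain ⟨l, rfl⟩ : ∃ k, l = k + 1 := ⟨l - 1, by omega⟩
      refine ⟨nodeEquiv p (Node.bush (l + 1) hl hne), rfl, (hasLevel_nodeEquiv_iff _ _).2 rfl,
        (branchesAt_nodeEquiv_iff rfl).2 ⟨rfl, rfl, rfl⟩, ?_⟩
      ext v
      obtain ⟨a, rfl⟩ := (nodeEquiv p).surjective v
      rw [Nat.add_sub_cancel, mem_bush_nodeEquiv_iff, Set.mem_insert_iff, Set.mem_singleton_iff,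
        (nodeEquiv p).injective.eq_iff, (nodeEquiv p).injective.eq_iff]
      exact or_congr (Node.ext_iff a (Node.stem p l)).symm
        (Node.ext_iff a (Node.bush (l + 1) hl hne)).symm
    · rintro rfl
      constructor
      · ext v
        obtain ⟨a, rfl⟩ := (nodeEquiv 2).surjective v
        rw [mem_bush_nodeEquiv_iff, Set.mem_singleton_iff, (nodeEquiv 2).injective.eq_iff]
        refine (or_iff_left fun h => (a.2 (by rw [h])).2 ?_).trans
          (Node.ext_iff a (Node.stem 2 0)).symm
        rw [h]
      · intro v
        obtain ⟨a, rfl⟩ := (nodeEquiv 2).surjective v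
        rw [hasLevel_nodeEquiv_iff, (nodeEquiv 2).injective.eq_iff]
        constructor
        · intro h
          rcases a.eq_stem_or_eq_bush with h' | ⟨hl, hne, -⟩
          · rwa [h] at h'
          · exact absurd (by rw [h]) hne
        · rintro rfl
          rfl
  · exact fun h2 => isPeriodicFrom 0 fun s _ h => h2 (congrArg Prod.fst h)
  · rintro rfl
    refine isPeriodicFrom 1 fun s hs h => ?_
    have := congrArg Prod.snd h
    simp only at this
    omega
  · exact fun _ => exists_levelIso 2 p
  · intro v G hG
    obtain ⟨a, rfl⟩ := (nodeEquiv p).surjective v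
    exact Node.rank_eq_two hG
  · intro l hl G hcard hdef hcomm
    have hexp := (cyclicDeficiency_eq_one_iff hcard).1 hdef
    have key : (p = 2 → IsGKType p G) → (p, l) ≠ (2, 1) ∧ Nonempty (G ≃* BushGroup p l hl) := by
      intro h
      refine (nonempty_mulEquiv_of_card_of_exponent hl hcard hexp h).resolve_left ?_
      rintro ⟨e⟩
      exact hcomm fun a b => e.injective (by rw [map_mul, map_mul, mul_comm])
    have hGK : (p, l) ≠ (2, 1) → Nonempty (G ≃* BushGroup p l hl) → IsGKType p G := by
      rintro hne ⟨e⟩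
      exact ((Node.isGKType_iff (Node.type_bush l hl hne)).2
        (Nat.one_le_iff_ne_zero.1 hl)).congr e.symm
    refine ⟨⟨fun h => key fun _ => h, fun h => hGK h.1 h.2⟩, fun h2 => ?_⟩
    obtain ⟨hne, e⟩ := key fun h => absurd h h2
    exact ⟨e, hGK hne e⟩
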